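/- Let $n\ge 1$, $p\ge 2$, $0<\nu\le L$ and $M>0$. There is a constant $c=c(n,p,\nu,L,M)>0$ such that the following holds. Let $\Omega\subset\mathbb{R}^n$ be open, $0<T<\infty$, $\Omega_T=\Omega\times(0,T)$, and let $\mathcal{A}:\Omega_T\times\mathbb{R}^n\to\mathbb{R}^n$ be a Carathéodory function (measurable in $(x,t)$, continuous in $\xi$) such that for a.e. $(x,t)\in\Omega_T$ and all $\xi\ne\eta$ in $\mathbb{R}^n$ $$\mathcal{A}(x,t,\xi)\cdot\xi\ge\nu|\xi|^p,\qquad |\mathcal{A}(x,t,\xi)|\le L|\xi|^{p-1},\qquad (\mathcal{A}(x,t,\xi)-\mathcal{A}(x,t,\eta))\cdot(\xi-\eta)>0 .$$ Let $0<\alpha\le 1$ and put $$d_\alpha\big((x,t),(y,s)\big)=\max\big\{|x-y|,\,|t-s|^{1/(p+\alpha(2-p))}\big\},$$ $$Q_{r,\lambda}(x_0,t_0)=B(x_0,r)\times(t_0-\lambda^{2-p}r^p,\;t_0+\lambda^{2-p}r^p).$$ Weak solutions (supersolutions) $u$ of $\partial_t u-\operatorname{div}\mathcal{A}(x,t,\nabla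 u)=0$ in an open set $U$ are functions which, for every cylinder $\Omega'_{t_1,t_2}=\Omega'\times(t_1,t_2)\Subset U$, belong to $L^p(t_1,t_2;W^{1,p}(\Omega'))$ and satisfy $\int_{\Omega'_{t_1,t_2}} -u\,\partial_t\varphi+\mathcal{A}(x,t,\nabla u)\cdot\nabla\varphi\,dx\,dt=0$ for all $\varphi\in C_c^\infty(\Omega'_{t_1,t_2})$ (respectively $\ge 0$ for all such $\varphi\ge0$). Let $K\subset\Omega_T$ be compact and let $\psi:\overline{\Omega_T}\to\mathbb{R}$ be continuous with $$|\psi(z_1)-\psi(z_2)|\le M\,d_\alpha(z_1,z_2)^\alpha\qquad\text{for all } z_1\in K,\ z_2\in\Omega_T .$$ Let $u=R^\psi$ be the solution of the obstacle problem in $\Omega_T$ with obstacle $\psi$, that is: $u:\overline{\Omega_T}\to\mathbb{R}$ is continuous; $u\ge\psi$ in $\Omega_T$ and $u=\psi$ on the parabolic boundary $(\partial\Omega\times[0,T))\cup(\overline\Omega\times\{0\})$; $u$ is a weak supersolution in $\Omega_T$; $u$ is a weak solution in $\Omega_T\cap\{u>\psi\}$; and $v\ge u$ a.e. for every weak supersolution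 $v$ in $\Omega_T$ with $v\ge\psi$ a.e. Let $\mu=\partial_t u-\operatorname{div}\mathcal{A}(x,t,\nabla u)$ be the Riesz measure of $u$, i.e. the non-negative Radon measure on $\Omega_T$ with $$\int_{\Omega_T}-u\,\partial_t\varphi+\mathcal{A}(x,t,\nabla u)\cdot\nabla\varphi\,dx\,dt=\int_{\Omega_T}\varphi\,d\mu\qquad\text{for all }\varphi\in C_c^\infty(\Omega_T).$$ Then, for every $z_0\in K$ and every $r>0$ with $Q_{2r,(2r)^\alpha}(z_0)\Subset\Omega_T$, $$\mu\big(Q_{r,r^\alpha}(z_0)\big)\le c\,r^{n+\alpha}.$$ -/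

import Mathlib

open MeasureTheory Set
open scoped ContDiff

noncomputable section

namespace PParabolic

/-- Space `ℝⁿ` with its Euclidean norm. -/
abbrev Space (n : ℕ) : Type := EuclideanSpace ℝ (Fin n)

/-- Space-time `ℝⁿ × ℝ`; points are `z = (x, t)`. -/
abbrev SpaceTime (n : ℕ) : Type := Space n × ℝ

variable {n : ℕ}

/-- The space-time cylinder `Ω_{t₁,t₂} = Ω × (t₁, t₂)`. -/
def cylinder (Ω : Set (Space n)) (t₁ t₂ : ℝ) : Set (SpaceTime n) := Ω ×ˢ Ioo t₁ t₂

/-- The parabolic boundary `(∂Ω × [t₁, t₂)) ∪ (closure Ω × {t₁})` of `Ω_{t₁,t₂}`. -/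
def parabolicBoundary (Ω : Set (Space n)) (t₁ t₂ : ℝ) : Set (SpaceTime n) :=
  (frontier Ω ×ˢ Ico t₁ t₂) ∪ (closure Ω ×ˢ {t₁})

/-- `V ⋐ U`: the closure of `V` is compact and contained in `U`. -/
def CompactlyContained {X : Type*} [TopologicalSpace X] (V U : Set X) : Prop :=
  IsCompact (closure V) ∧ closure V ⊆ U

/-- The intrinsic cylinder
`Q_{r,lam}(x₀,t₀) = B(x₀,r) × (t₀ - lam^(2-p) r^p, t₀ + lam^(2-p) r^p)`. -/
def intrinsicCylinder (p r lam : ℝ) (z₀ : SpaceTime n) : Set (SpaceTime n) :=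
  Metric.ball z₀.1 r ×ˢ Ioo (z₀.2 - lam ^ (2 - p) * r ^ p) (z₀.2 + lam ^ (2 - p) * r ^ p)

/-- The metric `d_α((x,t),(y,s)) = max {|x - y|, |t - s|^(1/(p + α(2 - p)))}`. -/
def dAlpha (p α : ℝ) (z w : SpaceTime n) : ℝ :=
  max ‖z.1 - w.1‖ (|z.2 - w.2| ^ (1 / (p + α * (2 - p))))

/-- `φ ∈ C_c^∞(U)` (a function on the whole space, with compact support inside `U`). -/
def IsTestFunction {X : Type*} [NormedAddCommGroup X] [NormedSpace ℝ X]
    (U : Set X) (φ : X → ℝ) : Prop :=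
  ContDiff ℝ ∞ φ ∧ HasCompactSupport φ ∧ tsupport φ ⊆ U

/-- The spatial gradient `∇φ(x,t)` of a smooth function on space-time. -/
def spaceGradient (φ : SpaceTime n → ℝ) (z : SpaceTime n) : Space n :=
  gradient (fun y => φ (y, z.2)) z.1

/-- The time derivative `∂_t φ(x,t)` of a smooth function on space-time. -/
def timeDeriv (φ : SpaceTime n → ℝ) (z : SpaceTime n) : ℝ :=
  deriv (fun s => φ (z.1, s)) z.2

/-- `f ∈ W^{1,q}(Ω)` with weak gradient `g`. -/
structure HasSobolevGradient (q : ℝ) (Ω : Set (Space n)) (f : Space n → ℝ)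
    (g : Space n → Space n) : Prop where
  memLp : MemLp f (ENNReal.ofReal q) (volume.restrict Ω)
  memLp_grad : MemLp g (ENNReal.ofReal q) (volume.restrict Ω)
  integral_eq : ∀ φ : Space n → ℝ, IsTestFunction Ω φ →
    ∫ x in Ω, f x • gradient φ x = - ∫ x in Ω, φ x • g x

/-- `u ∈ L^q(t₁,t₂; W^{1,q}(Ω))` with (jointly measurable) weak spatial gradient `G`: almost every
time slice lies in `W^{1,q}(Ω)`, and the `q`-th power of the Sobolev norm of the slices is
integrable in time. -/
structure HasParabolicGradient (q : ℝ) (Ω : Set (Space n)) (t₁ t₂ : ℝ) (u : SpaceTime n → ℝ)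
    (G : SpaceTime n → Space n) : Prop where
  aestronglyMeasurable : AEStronglyMeasurable u (volume.restrict (cylinder Ω t₁ t₂))
  aestronglyMeasurable_grad : AEStronglyMeasurable G (volume.restrict (cylinder Ω t₁ t₂))
  slice : ∀ᵐ t ∂(volume.restrict (Ioo t₁ t₂)),
    HasSobolevGradient q Ω (fun x => u (x, t)) (fun x => G (x, t))
  lintegral_lt_top :
    ∫⁻ t in Ioo t₁ t₂, ∫⁻ x in Ω, (‖u (x, t)‖ₑ ^ q + ‖G (x, t)‖ₑ ^ q) < ⊤

/-- `u` belongs to `L^q(t₁,t₂; W^{1,q}(Ω'))` for every cylinder `Ω'_{t₁,t₂} ⋐ U`, and `G` is its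
weak spatial gradient in `U`. -/
def HasLocalParabolicGradient (q : ℝ) (U : Set (SpaceTime n)) (u : SpaceTime n → ℝ)
    (G : SpaceTime n → Space n) : Prop :=
  ∀ (Ω' : Set (Space n)) (t₁ t₂ : ℝ), IsOpen Ω' → CompactlyContained (cylinder Ω' t₁ t₂) U →
    HasParabolicGradient q Ω' t₁ t₂ u G

/-- The structural assumptions on `A : Ω_T × ℝⁿ → ℝⁿ` (here `U = Ω_T`): the Carathéodory
conditions, coercivity and growth of order `p`, and strict monotonicity. -/
structure IsAdmissibleOperator (p ν L : ℝ) (U : Set (SpaceTime n))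
    (A : SpaceTime n → Space n → Space n) : Prop where
  aemeasurable : ∀ ξ, AEMeasurable (fun z => A z ξ) (volume.restrict U)
  continuous : ∀ᵐ z ∂(volume.restrict U), Continuous (A z)
  coercive : ∀ᵐ z ∂(volume.restrict U), ∀ ξ, ν * ‖ξ‖ ^ p ≤ inner ℝ (A z ξ) ξ
  growth : ∀ᵐ z ∂(volume.restrict U), ∀ ξ, ‖A z ξ‖ ≤ L * ‖ξ‖ ^ (p - 1)
  strictMono : ∀ᵐ z ∂(volume.restrict U), ∀ ξ η, ξ ≠ η → 0 < inner ℝ (A z ξ - A z η) (ξ - η)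

/-- `∫_V (-u ∂_t φ + A(x,t,G) · ∇φ) dx dt`, where `G` is the weak spatial gradient of `u`. -/
def weakForm (A : SpaceTime n → Space n → Space n) (V : Set (SpaceTime n))
    (u : SpaceTime n → ℝ) (G : SpaceTime n → Space n) (φ : SpaceTime n → ℝ) : ℝ :=
  ∫ z in V, (-(u z) * timeDeriv φ z + inner ℝ (A z (G z)) (spaceGradient φ z))

/-- `u` is a weak solution of `∂_t u - div A(x,t,∇u) = 0` in `U`. -/
def IsWeakSolution (p : ℝ) (A : SpaceTime n → Space n → Space n) (U : Set (SpaceTime n))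
    (u : SpaceTime n → ℝ) : Prop :=
  ∃ G : SpaceTime n → Space n, HasLocalParabolicGradient p U u G ∧
    ∀ (Ω' : Set (Space n)) (t₁ t₂ : ℝ), IsOpen Ω' → CompactlyContained (cylinder Ω' t₁ t₂) U →
      ∀ φ : SpaceTime n → ℝ, IsTestFunction (cylinder Ω' t₁ t₂) φ →
        weakForm A (cylinder Ω' t₁ t₂) u G φ = 0

/-- `u` is a weak supersolution of `∂_t u - div A(x,t,∇u) = 0` in `U`. -/
def IsWeakSupersolution (p : ℝ) (A : SpaceTime n → Space n → Space n) (U : Set (SpaceTime n))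
    (u : SpaceTime n → ℝ) : Prop :=
  ∃ G : SpaceTime n → Space n, HasLocalParabolicGradient p U u G ∧
    ∀ (Ω' : Set (Space n)) (t₁ t₂ : ℝ), IsOpen Ω' → CompactlyContained (cylinder Ω' t₁ t₂) U →
      ∀ φ : SpaceTime n → ℝ, IsTestFunction (cylinder Ω' t₁ t₂) φ → (∀ z, 0 ≤ φ z) →
        0 ≤ weakForm A (cylinder Ω' t₁ t₂) u G φ

/-- `μ` is a (non-negative) Radon measure on `U`. Only its values on subsets of `U` matter. -/
def IsRadonOn (U : Set (SpaceTime n)) (μ : Measure (SpaceTime n)) : Prop :=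
  ∀ C : Set (SpaceTime n), IsCompact C → C ⊆ U → μ C < ⊤

/-- `μ` is a Radon measure on `U` and `∂_t u - div A(x,t,∇u) = μ` weakly in `U`, for
`u ∈ L^{p-1}_loc(W^{1,p-1}_loc)`. For a weak supersolution `u` these properties determine `μ` on
`U`, and `μ` is the Riesz measure of `u`. -/
def IsRieszMeasure (p : ℝ) (A : SpaceTime n → Space n → Space n) (U : Set (SpaceTime n))
    (u : SpaceTime n → ℝ) (μ : Measure (SpaceTime n)) : Prop :=
  IsRadonOn U μ ∧
    ∃ G : SpaceTime n → Space n, HasLocalParabolicGradient (p - 1) U u G ∧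
      ∀ φ : SpaceTime n → ℝ, IsTestFunction U φ → weakForm A U u G φ = ∫ z in U, φ z ∂μ

/-- `u = R^ψ`: `u` is the solution of the obstacle problem in `Ω_{t₁,t₂}` with obstacle `ψ` (and
boundary values `ψ` on the parabolic boundary). Competitors `v` in the minimality condition are
defined up to null sets, so they are compared almost everywhere. -/
structure IsObstacleSolution (p : ℝ) (A : SpaceTime n → Space n → Space n)
    (Ω : Set (Space n)) (t₁ t₂ : ℝ) (ψ u : SpaceTime n → ℝ) : Prop where
  continuousOn : ContinuousOn u (closure (cylinder Ω t₁ t₂))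
  obstacle_le : ∀ z ∈ cylinder Ω t₁ t₂, ψ z ≤ u z
  boundary : ∀ z ∈ parabolicBoundary Ω t₁ t₂, u z = ψ z
  supersolution : IsWeakSupersolution p A (cylinder Ω t₁ t₂) u
  solution_off_contact : IsWeakSolution p A {z ∈ cylinder Ω t₁ t₂ | ψ z < u z} u
  minimal : ∀ v : SpaceTime n → ℝ, IsWeakSupersolution p A (cylinder Ω t₁ t₂) v →
    (∀ᵐ z ∂(volume.restrict (cylinder Ω t₁ t₂)), ψ z ≤ v z) →
    ∀ᵐ z ∂(volume.restrict (cylinder Ω t₁ t₂)), u z ≤ v z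

end PParabolic

end

/-!
# The Riesz measure of an obstacle solution on intrinsic cylinders

Write `R = 2 r`, let `D` be the cylinder `Q_{R, R^α}(z₀)`, of half-length `T = R^(p + α(2 - p))`,
and put `δ = M R^α`. On `D` the obstacle differs from `ψ(z₀)` by at most `δ`, because every point of
`D` is at `d_α`-distance at most `R` from `z₀`. Two observations then reduce the claim to a single
energy estimate, without any bound for `u` from above.

* `μ` does not charge the open set `{u > ψ}`, where `u` is a solution
  (`measure_eq_zero_of_isWeakSolution`). Only the contact set counts, and there `u ≤ ψ(z₀) + δ`.
* Put `k = ψ(z₀) + 2 δ` and `w = (k - u)₊`. Then `w ≤ 3 δ` on `D`, as `u ≥ ψ ≥ ψ(z₀) - δ`, while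
  `w ≥ δ` on the contact set. Testing the equation with `w² χ^m`, for a cut-off function `χ` and an
  integer `m ≥ p`, gives `∫ w² χ^m dμ ≥ δ² μ(Q_r ∩ {u = ψ})` on the measure side. On the other side,
  the time term is the integral of `w³ / 3` against `∂_t χ^m`, and the space term is
  `∫ (-2 w χ^m A(∇u) · ∇u + w² A(∇u) · ∇χ^m)`. Coercivity makes its first summand non-positive, and
  Young's inequality lets that summand absorb the second (`inner_test_le`). The result is a multiple
  of `|D| (δ³ / T + δ (δ / R)^p)`, which is `δ² R^(n + α)` up to a constant
  (`sq_mul_measure_contact_le`).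

The function `w² χ^m` is not an admissible test function: `u` has no time derivative. With a
mollifier `ρ`, the smooth function `ρ ⋆ (f(ρ ⋆ u) φ)` is tested instead. Since `ρ` is even, the
outer mollification can be moved to the other factor, where it produces `ρ ⋆ u` and `ρ ⋆ A(∇u)`; the
time term then contains `f(ρ ⋆ u) ∂_t (ρ ⋆ u)`, an exact derivative (`integral_mollified_test`). The
radius of `ρ` tends to `0` in `tendsto_mollified_test`, by the convergence of `ρ ⋆ ∇u` in `L^p`, of
`ρ ⋆ A(∇u)` in the dual space and of `ρ ⋆ u` locally uniformly. The gradients in the definitions of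
supersolution, of solution off the contact set and of Riesz measure are a priori different
functions; they agree by `HasParabolicGradient.ae_eq`.
-/

namespace PParabolic

open Filter Topology Metric
open scoped Convolution ENNReal Pointwise

noncomputable section

variable {n : ℕ}

/-- Instance search does not see `volume` on space-time as a product measure by itself. -/
instance instIsAddHaarMeasureSpaceTime (n : ℕ) :
    (volume : Measure (SpaceTime n)).IsAddHaarMeasure :=
  Measure.prod.instIsAddHaarMeasure volume volume

/-! ### Mollification in `L^q` -/

section Mollification

variable {E : Type*} [NormedAddCommGroup E] [NormedSpace ℝ E] [FiniteDimensional ℝ E]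
  [MeasurableSpace E] [BorelSpace E] {m : Measure E} [m.IsAddHaarMeasure]
  {F : Type*} [NormedAddCommGroup F]

/-- Translations act continuously on `L^q`. -/
theorem tendsto_eLpNorm_comp_sub_sub_self {q : ℝ} (hq : 1 ≤ q) {g : E → F}
    (hg : MemLp g (ENNReal.ofReal q) m) :
    Tendsto (fun y : E => eLpNorm (fun x => g (x - y) - g x) (ENNReal.ofReal q) m) (𝓝 0) (𝓝 0) := by
  have : Fact (1 ≤ ENNReal.ofReal q) := ⟨by simpa using ENNReal.ofReal_le_ofReal hq⟩
  let s : C(E × E, E) := ⟨fun z => z.2 - z.1, by fun_prop⟩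
  have hmp : ∀ y : E, MeasurePreserving (s.curry y) m m := fun y => measurePreserving_sub_right m y
  have h := Filter.Tendsto.compMeasurePreservingLp (l := 𝓝 (0 : E))
    (tendsto_const_nhds (x := hg.toLp g)) (s.curry.continuous.tendsto 0) hmp (hmp 0)
    ENNReal.ofReal_ne_top
  have h2 := (tendsto_iff_edist_tendsto_0.1 h)
  refine h2.congr fun y => ?_
  have e : ∀ y, Lp.compMeasurePreserving (s.curry y) (hmp y) (hg.toLp g) =
    (hg.comp_measurePreserving (hmp y)).toLp (g ∘ s.curry y) := fun y => rfl
  rw [e, e, Lp.edist_toLp_toLp]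
  congr 1
  ext x
  simp [s]

variable [NormedSpace ℝ F] [CompleteSpace F]

/-- Mollification is controlled by translations, by Jensen's inequality for the probability
measure whose density is the mollifier. -/
theorem eLpNorm_normed_convolution_sub_le {q : ℝ} (hq : 1 ≤ q) {g : E → F}
    (hg : MemLp g (ENNReal.ofReal q) m) (φ : ContDiffBump (0 : E)) {η : ℝ≥0∞}
    (hη : ∀ y ∈ ball (0 : E) φ.rOut,
      eLpNorm (fun x => g (x - y) - g x) (ENNReal.ofReal q) m ≤ η) :
    eLpNorm ((φ.normed m ⋆[ContinuousLinearMap.lsmul ℝ ℝ, m] g) - g) (ENNReal.ofReal q) m ≤ η := by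
  have hq0 : 0 < q := by linarith
  have hq1 : 1 ≤ ENNReal.ofReal q := by simpa using ENNReal.ofReal_le_ofReal hq
  set ρ : E → ℝ≥0∞ := fun y => ‖φ.normed m y‖ₑ with hρ
  have hρm : Measurable ρ := φ.continuous_normed.measurable.enorm
  have hρ1 : ∫⁻ y, ρ y ∂m = 1 := by
    have := φ.integral_normed (μ := m)
    rw [integral_eq_lintegral_of_nonneg_ae (Eventually.of_forall φ.nonneg_normed)
      φ.continuous_normed.aestronglyMeasurable] at this
    rw [← ENNReal.toReal_eq_one_iff, ← this]
    congr 1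
    refine lintegral_congr fun y => ?_
    simp only [hρ, Real.enorm_eq_ofReal (φ.nonneg_normed y)]
  set P := m.withDensity ρ with hP
  have : IsProbabilityMeasure P := ⟨by
    rw [hP, withDensity_apply _ MeasurableSet.univ, Measure.restrict_univ, hρ1]⟩
  have hPac : P ≪ m := withDensity_absolutelyContinuous _ _
  -- joint measurability
  have hmeas : AEStronglyMeasurable (fun z : E × E => g (z.1 - z.2) - g z.1) (m.prod P) := by
    refine AEStronglyMeasurable.sub ?_ ?_
    · refine hg.1.comp_quasiMeasurePreserving ?_
      exact (quasiMeasurePreserving_sub_of_right_invariant m m).mono_left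
        (Measure.AbsolutelyContinuous.rfl.prod hPac)
    · exact hg.1.comp_fst
  -- pointwise bound
  have hpt : ∀ᵐ x ∂m, ‖((φ.normed m ⋆[ContinuousLinearMap.lsmul ℝ ℝ, m] g) - g) x‖ₑ ^ q ≤
      ∫⁻ y, ‖g (x - y) - g x‖ₑ ^ q ∂P := by
    filter_upwards [hmeas.prodMk_left] with x hx
    have hex : ConvolutionExistsAt (φ.normed m) g x (ContinuousLinearMap.lsmul ℝ ℝ) m :=
      φ.hasCompactSupport_normed.convolutionExists_left _ φ.continuous_normed
        (hg.locallyIntegrable hq1) x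
    have h1 : ((φ.normed m ⋆[ContinuousLinearMap.lsmul ℝ ℝ, m] g) - g) x =
        ∫ y, φ.normed m y • (g (x - y) - g x) ∂m := by
      have : g x = ∫ y, φ.normed m y • g x ∂m := by
        rw [integral_smul_const, φ.integral_normed, one_smul]
      rw [Pi.sub_apply, convolution_def]
      conv_lhs => rw [this]
      rw [← integral_sub]
      · simp [smul_sub]
      · exact hex
      · exact (φ.integrable_normed).smul_const _
    have h2 : ‖((φ.normed m ⋆[ContinuousLinearMap.lsmul ℝ ℝ, m] g) - g) x‖ₑ ≤
        ∫⁻ y, ‖g (x - y) - g x‖ₑ ∂P := by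
      rw [h1, hP, lintegral_withDensity_eq_lintegral_mul₀' hρm.aemeasurable]
      · refine (enorm_integral_le_lintegral_enorm _).trans (le_of_eq ?_)
        refine lintegral_congr fun y => ?_
        rw [enorm_smul]; rfl
      · exact hx.enorm
    have h3 := eLpNorm'_le_eLpNorm'_of_exponent_le (p := 1) (q := q) one_pos hq P hx
    simp only [eLpNorm', ENNReal.rpow_one, div_one] at h3
    calc _ ≤ ((∫⁻ y, ‖g (x - y) - g x‖ₑ ^ q ∂P) ^ (1 / q)) ^ q :=
          ENNReal.rpow_le_rpow (h2.trans (by simpa using h3)) hq0.le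
      _ = _ := by rw [← ENNReal.rpow_mul, one_div_mul_cancel hq0.ne', ENNReal.rpow_one]
  have key : ∀ f : E → F, eLpNorm f (ENNReal.ofReal q) m =
      (∫⁻ x, ‖f x‖ₑ ^ q ∂m) ^ (1 / q) := fun f => by
    rw [eLpNorm_eq_lintegral_rpow_enorm_toReal (by positivity) ENNReal.ofReal_ne_top,
      ENNReal.toReal_ofReal hq0.le]
  have hη' : ∀ y ∈ ball (0 : E) φ.rOut, ∫⁻ x, ‖g (x - y) - g x‖ₑ ^ q ∂m ≤ η ^ q := by
    intro y hy
    have := hη y hy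
    rw [key] at this
    calc _ = ((∫⁻ x, ‖g (x - y) - g x‖ₑ ^ q ∂m) ^ (1 / q)) ^ q := by
          rw [← ENNReal.rpow_mul, one_div_mul_cancel hq0.ne', ENNReal.rpow_one]
      _ ≤ _ := ENNReal.rpow_le_rpow this hq0.le
  rw [key]
  calc (∫⁻ x, ‖((φ.normed m ⋆[ContinuousLinearMap.lsmul ℝ ℝ, m] g) - g) x‖ₑ ^ q ∂m) ^ (1 / q)
      ≤ (∫⁻ x, ∫⁻ y, ‖g (x - y) - g x‖ₑ ^ q ∂P ∂m) ^ (1 / q) :=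
        ENNReal.rpow_le_rpow (lintegral_mono_ae hpt) (by positivity)
    _ = (∫⁻ y, ∫⁻ x, ‖g (x - y) - g x‖ₑ ^ q ∂m ∂P) ^ (1 / q) := by
        rw [lintegral_lintegral_swap]
        exact hmeas.enorm.pow_const q
    _ ≤ (∫⁻ _, η ^ q ∂P) ^ (1 / q) := by
        refine ENNReal.rpow_le_rpow (lintegral_mono_ae ?_) (by positivity)
        rw [hP, ae_withDensity_iff hρm]
        refine Eventually.of_forall fun y hy => hη' y ?_
        rw [← φ.support_normed_eq (μ := m)]
        intro h0
        exact hy (by simp [hρ, h0])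
    _ = η := by
        rw [lintegral_const, measure_univ, mul_one, ← ENNReal.rpow_mul,
          mul_one_div_cancel hq0.ne', ENNReal.rpow_one]

theorem tendsto_eLpNorm_normed_convolution_sub {q : ℝ} (hq : 1 ≤ q) {g : E → F}
    (hg : MemLp g (ENNReal.ofReal q) m) {φ : ℕ → ContDiffBump (0 : E)}
    (hφ : Tendsto (fun i => (φ i).rOut) atTop (𝓝 0)) :
    Tendsto (fun i => eLpNorm (((φ i).normed m ⋆[ContinuousLinearMap.lsmul ℝ ℝ, m] g) - g)
      (ENNReal.ofReal q) m) atTop (𝓝 0) := by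
  rw [ENNReal.tendsto_atTop_zero]
  intro η hη
  have h := (tendsto_eLpNorm_comp_sub_sub_self hq hg).eventually (eventually_le_nhds hη)
  obtain ⟨d, hd, hball⟩ := Metric.eventually_nhds_iff_ball.1 h
  obtain ⟨N, hN⟩ := eventually_atTop.1 (hφ.eventually (eventually_lt_nhds hd))
  refine ⟨N, fun i hi => eLpNorm_normed_convolution_sub_le hq hg _ fun y hy => hball y ?_⟩
  exact ball_subset_ball (hN i hi).le hy

theorem memLp_normed_convolution {q : ℝ} (hq : 1 ≤ q) {g : E → F}
    (hg : MemLp g (ENNReal.ofReal q) m) (φ : ContDiffBump (0 : E)) :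
    MemLp (φ.normed m ⋆[ContinuousLinearMap.lsmul ℝ ℝ, m] g) (ENNReal.ofReal q) m := by
  have hq1 : 1 ≤ ENNReal.ofReal q := by simpa using ENNReal.ofReal_le_ofReal hq
  have hc : Continuous (φ.normed m ⋆[ContinuousLinearMap.lsmul ℝ ℝ, m] g) :=
    φ.hasCompactSupport_normed.continuous_convolution_left _ φ.continuous_normed
      (hg.locallyIntegrable hq1)
  have h : MemLp ((φ.normed m ⋆[ContinuousLinearMap.lsmul ℝ ℝ, m] g) - g)
      (ENNReal.ofReal q) m := by
    refine ⟨hc.aestronglyMeasurable.sub hg.1, ?_⟩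
    refine (eLpNorm_normed_convolution_sub_le hq hg φ
      (η := 2 * eLpNorm g (ENNReal.ofReal q) m) fun y _ => ?_).trans_lt
      (ENNReal.mul_lt_top (by simp) hg.2)
    have hmp : MeasurePreserving (fun x : E => x - y) m m := measurePreserving_sub_right m y
    refine (eLpNorm_sub_le (hg.comp_measurePreserving hmp).1 hg.1 hq1).trans (le_of_eq ?_)
    rw [eLpNorm_comp_measurePreserving hg.1 hmp, two_mul]
  simpa using h.add hg

end Mollification

/-! ### Space and time derivatives of smooth functions -/

theorem timeDeriv_eq_fderiv {f : SpaceTime n → ℝ} {z : SpaceTime n}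
    (hf : DifferentiableAt ℝ f z) : timeDeriv f z = fderiv ℝ f z (0, 1) := by
  have h1 : HasDerivAt (fun s : ℝ => ((z.1, s) : SpaceTime n)) (0, 1) z.2 :=
    (hasDerivAt_const _ _).prodMk (hasDerivAt_id _)
  exact (hf.hasFDerivAt.comp_hasDerivAt z.2 h1).deriv

theorem spaceGradient_eq_toDual_symm {f : SpaceTime n → ℝ} {z : SpaceTime n}
    (hf : DifferentiableAt ℝ f z) :
    spaceGradient f z = (InnerProductSpace.toDual ℝ (Space n)).symm
      ((fderiv ℝ f z).comp (ContinuousLinearMap.inl ℝ (Space n) ℝ)) := by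
  have h1 : HasFDerivAt (fun y : Space n => ((y, z.2) : SpaceTime n))
      (ContinuousLinearMap.inl ℝ (Space n) ℝ) z.1 :=
    (hasFDerivAt_id _).prodMk (hasFDerivAt_const _ _)
  have h2 := (HasFDerivAt.comp (f := fun y : Space n => ((y, z.2) : SpaceTime n)) z.1
    (g := f) hf.hasFDerivAt h1).fderiv
  rw [spaceGradient, gradient]
  congr 1

theorem inner_spaceGradient {f : SpaceTime n → ℝ} {z : SpaceTime n}
    (hf : DifferentiableAt ℝ f z) (v : Space n) :
    inner ℝ v (spaceGradient f z) = fderiv ℝ f z (v, 0) := by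
  rw [spaceGradient_eq_toDual_symm hf, real_inner_comm, InnerProductSpace.toDual_symm_apply]
  simp

theorem continuous_spaceGradient {f : SpaceTime n → ℝ} (hf : ContDiff ℝ 1 f) :
    Continuous (spaceGradient f) := by
  have h : spaceGradient f = fun z => (InnerProductSpace.toDual ℝ (Space n)).symm
      ((fderiv ℝ f z).comp (ContinuousLinearMap.inl ℝ (Space n) ℝ)) :=
    funext fun z => spaceGradient_eq_toDual_symm (hf.differentiable one_ne_zero z)
  rw [h]
  exact (LinearIsometryEquiv.continuous _).comp
    ((hf.continuous_fderiv one_ne_zero).clm_comp continuous_const)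

theorem continuous_timeDeriv {f : SpaceTime n → ℝ} (hf : ContDiff ℝ 1 f) :
    Continuous (timeDeriv f) := by
  have h : timeDeriv f = fun z => fderiv ℝ f z (0, 1) :=
    funext fun z => timeDeriv_eq_fderiv (hf.differentiable one_ne_zero z)
  rw [h]
  exact (hf.continuous_fderiv one_ne_zero).clm_apply continuous_const

theorem spaceGradient_eq_zero_of_notMem_tsupport {f : SpaceTime n → ℝ} {z : SpaceTime n}
    (hz : z ∉ tsupport f) : spaceGradient f z = 0 := by
  have h : f =ᶠ[𝓝 z] fun _ => 0 := notMem_tsupport_iff_eventuallyEq.1 hz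
  have hd : DifferentiableAt ℝ f z := h.differentiableAt_iff.2 (differentiableAt_const _)
  rw [spaceGradient_eq_toDual_symm hd, h.fderiv_eq]
  simp

theorem timeDeriv_eq_zero_of_notMem_tsupport {f : SpaceTime n → ℝ} {z : SpaceTime n}
    (hz : z ∉ tsupport f) : timeDeriv f z = 0 := by
  have h : f =ᶠ[𝓝 z] fun _ => 0 := notMem_tsupport_iff_eventuallyEq.1 hz
  have hd : DifferentiableAt ℝ f z := h.differentiableAt_iff.2 (differentiableAt_const _)
  rw [timeDeriv_eq_fderiv hd, h.fderiv_eq]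
  simp

theorem hasCompactSupport_spaceGradient {f : SpaceTime n → ℝ} (hf : HasCompactSupport f) :
    HasCompactSupport (spaceGradient f) :=
  HasCompactSupport.intro hf fun _ => spaceGradient_eq_zero_of_notMem_tsupport

theorem hasCompactSupport_timeDeriv {f : SpaceTime n → ℝ} (hf : HasCompactSupport f) :
    HasCompactSupport (timeDeriv f) :=
  HasCompactSupport.intro hf fun _ => timeDeriv_eq_zero_of_notMem_tsupport

/-! ### Mollified functions on space-time -/

/-- The mollification `ρ ⋆ g` of `g` by the normalised bump function `ρ`. -/
abbrev mollify {E F : Type*} [NormedAddCommGroup E] [NormedSpace ℝ E] [FiniteDimensional ℝ E]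
    [MeasureSpace E] [BorelSpace E] [NormedAddCommGroup F] [NormedSpace ℝ F]
    (ρ : ContDiffBump (0 : E)) (g : E → F) : E → F :=
  ρ.normed volume ⋆[ContinuousLinearMap.lsmul ℝ ℝ, volume] g

section Adjoint

variable {E : Type*} [NormedAddCommGroup E] [NormedSpace ℝ E] [FiniteDimensional ℝ E]
  [MeasureSpace E] [BorelSpace E]
  {F : Type*} [NormedAddCommGroup F] [InnerProductSpace ℝ F] [CompleteSpace F]

theorem mollify_nonneg (ρ : ContDiffBump (0 : E)) {g : E → ℝ} (h : ∀ y, 0 ≤ g y) (x : E) :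
    0 ≤ mollify ρ g x :=
  integral_nonneg fun t => mul_nonneg (ρ.nonneg_normed t) (h _)

variable [(volume : Measure E).IsAddHaarMeasure]

/-- Mollification is symmetric for the `L²` pairing, because the kernel is even. -/
theorem integral_inner_mollify (ρ : ContDiffBump (0 : E)) {a b : E → F} (ha : Integrable a)
    (hb : Integrable b) :
    ∫ x, inner ℝ (a x) (mollify ρ b x) = ∫ x, inner ℝ (mollify ρ a x) (b x) := by
  have hrb : ∃ C, ∀ x, ‖ρ.normed volume x‖ ≤ C :=
    ρ.continuous_normed.bounded_above_of_compact_support ρ.hasCompactSupport_normed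
  obtain ⟨C, hC⟩ := hrb
  have hint : Integrable (fun z : E × E => ρ.normed volume (z.1 - z.2) * inner ℝ (a z.1) (b z.2))
      (volume.prod volume) := by
    refine Integrable.bdd_mul (c := C) ?_ ?_ ?_
    · refine Integrable.mono' (ha.norm.mul_prod hb.norm) ?_ ?_
      · exact ha.1.comp_fst.inner hb.1.comp_snd
      · exact Eventually.of_forall fun z => norm_inner_le_norm _ _
    · exact (ρ.continuous_normed.comp (continuous_fst.sub continuous_snd)).aestronglyMeasurable
    · exact Eventually.of_forall fun z => hC _
  have hsm : ∀ (g : E → F), Integrable g → ∀ x,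
      Integrable (fun y => ρ.normed volume (x - y) • g y) := fun g hg x => by
    refine Integrable.bdd_smul (φ := fun y => ρ.normed volume (x - y)) hg C ?_ ?_
    · exact (ρ.continuous_normed.comp (continuous_const.sub continuous_id)).aestronglyMeasurable
    · exact Eventually.of_forall fun z => hC _
  have h1 : ∀ x, inner ℝ (a x) (mollify ρ b x) =
      ∫ y, ρ.normed volume (x - y) * inner ℝ (a x) (b y) := fun x => by
    rw [mollify, convolution_lsmul_swap, ← integral_inner (hsm b hb x)]
    simp only [inner_smul_right]
  have h2 : ∀ y, inner ℝ (mollify ρ a y) (b y) =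
      ∫ x, ρ.normed volume (x - y) * inner ℝ (a x) (b y) := fun y => by
    rw [mollify, convolution_lsmul_swap, real_inner_comm, ← integral_inner (hsm a ha y)]
    refine integral_congr_ae (Eventually.of_forall fun x => ?_)
    simp only [inner_smul_right]
    rw [real_inner_comm, ← ρ.normed_neg, neg_sub]
  simp only [h1, h2]
  exact integral_integral_swap hint

theorem le_mollify (ρ : ContDiffBump (0 : E)) {g : E → ℝ} (hg : Continuous g) {x : E} {c : ℝ}
    (h : ∀ y ∈ ball x ρ.rOut, c ≤ g y) : c ≤ mollify ρ g x := by
  have hex : ConvolutionExistsAt (ρ.normed volume) g x (ContinuousLinearMap.lsmul ℝ ℝ) volume :=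
    ρ.hasCompactSupport_normed.convolutionExists_left _ ρ.continuous_normed
      hg.locallyIntegrable x
  have h1 : c = ∫ t, ρ.normed volume t * c := by
    rw [integral_mul_const, ρ.integral_normed, one_mul]
  rw [h1, mollify, convolution_lsmul]
  refine integral_mono (ρ.integrable_normed.mul_const c) hex fun t => ?_
  by_cases ht : t ∈ ball (0 : E) ρ.rOut
  · refine mul_le_mul_of_nonneg_left (h _ ?_) (ρ.nonneg_normed t)
    simpa [mem_ball, dist_eq_norm] using ht
  · have : ρ.normed volume t = 0 := by
      rw [← ρ.support_normed_eq (μ := volume)] at ht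
      simpa using ht
    simp [this]

end Adjoint

theorem contDiff_mollify (ρ : ContDiffBump (0 : SpaceTime n)) {g : SpaceTime n → ℝ}
    (hg : LocallyIntegrable g) : ContDiff ℝ ∞ (mollify ρ g) :=
  ρ.hasCompactSupport_normed.contDiff_convolution_left _ ρ.contDiff_normed hg

theorem fderiv_mollify_apply (ρ : ContDiffBump (0 : SpaceTime n)) {g : SpaceTime n → ℝ}
    (hg : ContDiff ℝ 1 g) (hgc : HasCompactSupport g) (z v : SpaceTime n) :
    fderiv ℝ (mollify ρ g) z v = mollify ρ (fun y => fderiv ℝ g y v) z := by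
  have h := (hgc.hasFDerivAt_convolution_right (μ := volume) (ContinuousLinearMap.lsmul ℝ ℝ)
    (ρ.continuous_normed (μ := volume)).locallyIntegrable hg z).fderiv
  rw [mollify, h, convolution_precompR_apply]
  · exact ρ.continuous_normed.locallyIntegrable
  · exact hgc.fderiv ℝ
  · exact hg.continuous_fderiv one_ne_zero

theorem timeDeriv_mollify (ρ : ContDiffBump (0 : SpaceTime n)) {g : SpaceTime n → ℝ}
    (hg : ContDiff ℝ 1 g) (hgc : HasCompactSupport g) :
    timeDeriv (mollify ρ g) = mollify ρ (timeDeriv g) := by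
  ext z
  have hm : ContDiff ℝ ∞ (mollify ρ g) := contDiff_mollify ρ hg.continuous.locallyIntegrable
  rw [timeDeriv_eq_fderiv (hm.differentiable (by simp) z), fderiv_mollify_apply ρ hg hgc]
  congr 1
  ext y
  exact (timeDeriv_eq_fderiv (hg.differentiable one_ne_zero y)).symm

theorem spaceGradient_mollify (ρ : ContDiffBump (0 : SpaceTime n)) {g : SpaceTime n → ℝ}
    (hg : ContDiff ℝ 1 g) (hgc : HasCompactSupport g) :
    spaceGradient (mollify ρ g) = mollify ρ (spaceGradient g) := by
  ext1 z
  have hm : ContDiff ℝ ∞ (mollify ρ g) := contDiff_mollify ρ hg.continuous.locallyIntegrable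
  refine ext_inner_left ℝ fun v => ?_
  rw [inner_spaceGradient (hm.differentiable (by simp) z), fderiv_mollify_apply ρ hg hgc]
  have hex : ConvolutionExistsAt (ρ.normed volume) (spaceGradient g) z
      (ContinuousLinearMap.lsmul ℝ ℝ) volume :=
    ρ.hasCompactSupport_normed.convolutionExists_left _ ρ.continuous_normed
      (continuous_spaceGradient hg).locallyIntegrable z
  rw [mollify, mollify, convolution_lsmul, convolution_lsmul]
  refine Eq.trans ?_ (integral_inner hex v)
  refine integral_congr_ae (Eventually.of_forall fun t => ?_)
  simp only [ContinuousLinearMap.lsmul_apply, inner_smul_right, smul_eq_mul]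
  rw [inner_spaceGradient (hg.differentiable one_ne_zero _)]

/-- Where the mollifier does not see the complement of the cylinder, the gradient of the
mollification of `u` is the mollification of the weak gradient. -/
theorem spaceGradient_mollify_indicator {q : ℝ} {B : Set (Space n)} {t₁ t₂ : ℝ} (hB : IsOpen B)
    {u : SpaceTime n → ℝ} {G : SpaceTime n → Space n} (h : HasParabolicGradient q B t₁ t₂ u G)
    (hu : IntegrableOn u (cylinder B t₁ t₂)) (hG : IntegrableOn G (cylinder B t₁ t₂))
    (ρ : ContDiffBump (0 : SpaceTime n)) {z : SpaceTime n}
    (hz : closedBall z ρ.rOut ⊆ cylinder B t₁ t₂) :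
    spaceGradient (mollify ρ ((cylinder B t₁ t₂).indicator u)) z =
      mollify ρ ((cylinder B t₁ t₂).indicator G) z := by
  set D := cylinder B t₁ t₂ with hD
  have hDm : MeasurableSet D := (hB.prod isOpen_Ioo).measurableSet
  set w := ρ.normed volume with hw
  have hw1 : ContDiff ℝ 1 w := ρ.contDiff_normed
  have hwc : HasCompactSupport w := ρ.hasCompactSupport_normed
  have hui : Integrable (D.indicator u) := (integrable_indicator_iff hDm).2 hu
  have hm : ContDiff ℝ ∞ (mollify ρ (D.indicator u)) := contDiff_mollify ρ hui.locallyIntegrable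
  obtain ⟨C₁, hC₁⟩ := (continuous_spaceGradient hw1).bounded_above_of_compact_support
    (hasCompactSupport_spaceGradient hwc)
  obtain ⟨C₂, hC₂⟩ := hw1.continuous.bounded_above_of_compact_support hwc
  have hi1 : IntegrableOn (fun y => u y • spaceGradient w (z - y)) D := by
    refine Integrable.smul_bdd (f := fun y => spaceGradient w (z - y)) hu C₁ ?_ ?_
    · exact ((continuous_spaceGradient hw1).comp
        (continuous_const.sub continuous_id)).aestronglyMeasurable
    · exact Eventually.of_forall fun y => hC₁ _
  have hi2 : IntegrableOn (fun y => w (z - y) • G y) D := by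
    refine Integrable.bdd_smul (φ := fun y => w (z - y)) hG C₂ ?_ ?_
    · exact (hw1.continuous.comp (continuous_const.sub continuous_id)).aestronglyMeasurable
    · exact Eventually.of_forall fun y => hC₂ _
  -- Both sides are integrals over the cylinder; on almost every time slice the definition of the
  -- weak gradient, with the kernel as test function, identifies the inner integrals.
  have hL : spaceGradient (mollify ρ (D.indicator u)) z =
      ∫ y in D, u y • spaceGradient w (z - y) := by
    refine ext_inner_left ℝ fun v => ?_
    rw [inner_spaceGradient (hm.differentiable (by simp) z), ← integral_inner hi1]
    have hf := (hwc.hasFDerivAt_convolution_left (μ := volume) (ContinuousLinearMap.lsmul ℝ ℝ)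
      hw1 hui.locallyIntegrable z)
    have hex := (hwc.fderiv ℝ).convolutionExists_left (μ := volume)
      (ContinuousLinearMap.precompL (SpaceTime n) (ContinuousLinearMap.lsmul ℝ ℝ))
      (hw1.continuous_fderiv one_ne_zero) hui.locallyIntegrable z
    rw [hf.fderiv, convolution_eq_swap, ContinuousLinearMap.integral_apply,
      ← integral_indicator hDm]
    · refine integral_congr_ae (Eventually.of_forall fun y => ?_)
      by_cases hy : y ∈ D
      · simp only [indicator_of_mem hy, ContinuousLinearMap.precompL_apply,
          ContinuousLinearMap.lsmul_apply, inner_smul_right]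
        rw [inner_spaceGradient (hw1.differentiable one_ne_zero _)]
        simp [mul_comm]
      · simp [indicator_of_notMem hy]
    · exact hex.integrable_swap
  have hR : mollify ρ (D.indicator G) z = ∫ y in D, w (z - y) • G y := by
    rw [mollify, convolution_lsmul_swap, ← integral_indicator hDm]
    refine integral_congr_ae (Eventually.of_forall fun y => ?_)
    by_cases hy : y ∈ D <;> simp [hy, hw]
  rw [hL, hR]
  have hDp : volume.restrict D = ((volume : Measure (Space n)).restrict B).prod
      ((volume : Measure ℝ).restrict (Ioo t₁ t₂)) := by
    rw [hD, cylinder, Measure.volume_eq_prod, Measure.prod_restrict]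
  rw [IntegrableOn, hDp] at hi1 hi2
  rw [hDp, integral_prod_symm _ hi1, integral_prod_symm _ hi2]
  refine integral_congr_ae ?_
  filter_upwards [h.slice] with t ht
  set χ : Space n → ℝ := fun x => w (z - (x, t)) with hχ
  have hmem : ∀ x, χ x ≠ 0 → (x, t) ∈ closedBall z ρ.rOut := fun x hx => by
    have : z - (x, t) ∈ ball (0 : SpaceTime n) ρ.rOut := by
      rw [← ρ.support_normed_eq (μ := volume)]; exact hx
    rw [mem_closedBall, dist_comm, dist_eq_norm]
    exact (mem_ball_zero_iff.1 this).le
  have hclosed : IsClosed {x : Space n | (x, t) ∈ closedBall z ρ.rOut} :=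
    isClosed_closedBall.preimage (by fun_prop : Continuous fun x : Space n => (x, t))
  have hts : tsupport χ ⊆ {x : Space n | (x, t) ∈ closedBall z ρ.rOut} :=
    closure_minimal hmem hclosed
  have htest : IsTestFunction B χ := by
    refine ⟨?_, ?_, fun x hx => (hz (hts hx)).1⟩
    · exact (ρ.contDiff_normed (μ := volume)).comp (by fun_prop)
    · refine HasCompactSupport.intro (isCompact_closedBall z.1 ρ.rOut) fun x hx => ?_
      by_contra h0
      have := hmem x h0
      rw [mem_closedBall, Prod.dist_eq, max_le_iff] at this
      exact hx this.1
  have hgrad : ∀ x, gradient χ x = -spaceGradient w (z - (x, t)) := fun x => by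
    have h1 : HasFDerivAt (fun y : Space n => z - (y, t))
        (-(ContinuousLinearMap.inl ℝ (Space n) ℝ)) x := by
      have h0 : HasFDerivAt (fun y : Space n => ((y, t) : SpaceTime n))
          (ContinuousLinearMap.inl ℝ (Space n) ℝ) x :=
        (hasFDerivAt_id x).prodMk (hasFDerivAt_const t x)
      exact h0.const_sub z
    have h2 := ((hw1.differentiable one_ne_zero (z - (x, t))).hasFDerivAt.comp x h1).fderiv
    rw [spaceGradient_eq_toDual_symm (hw1.differentiable one_ne_zero _), ← map_neg, gradient]
    congr 1
    exact h2.trans (by ext; simp)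
  have h3 := ht.integral_eq χ htest
  simp only [hgrad, smul_neg, integral_neg, neg_inj] at h3
  exact h3

/-! ### The tested equation before the limit -/

theorem integral_timeDeriv_eq_zero {H : SpaceTime n → ℝ} (hH : ContDiff ℝ 1 H)
    (hc : HasCompactSupport H) : ∫ z, timeDeriv H z = 0 := by
  have hd : ∀ z, DifferentiableAt ℝ H z := hH.differentiable one_ne_zero
  have h := integral_mul_fderiv_eq_neg_fderiv_mul_of_integrable (μ := volume)
    (f := fun _ : SpaceTime n => (1 : ℝ)) (g := H) (v := (0, 1)) (by simp) (by
      simp only [one_mul, ← timeDeriv_eq_fderiv (hd _)]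
      exact (continuous_timeDeriv hH).integrable_of_hasCompactSupport
        (hasCompactSupport_timeDeriv hc)) (by
      simpa using hH.continuous.integrable_of_hasCompactSupport hc)
    (by simp) fun z _ => hd z
  simpa [← timeDeriv_eq_fderiv (hd _)] using h

/-- Testing the equation with `ρ ⋆ (f(ρ ⋆ u) φ)`: all derivatives fall on smooth functions, and the
time derivative is integrated through the primitive `F` of `f`. -/
theorem integral_mollified_test {q : ℝ} {B : Set (Space n)} {t₁ t₂ : ℝ} (hB : IsOpen B)
    {u : SpaceTime n → ℝ} {G a : SpaceTime n → Space n} (h : HasParabolicGradient q B t₁ t₂ u G)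
    (hu : IntegrableOn u (cylinder B t₁ t₂)) (hG : IntegrableOn G (cylinder B t₁ t₂))
    (ha : IntegrableOn a (cylinder B t₁ t₂)) (ρ : ContDiffBump (0 : SpaceTime n))
    {φ : SpaceTime n → ℝ} (hφ : ContDiff ℝ 1 φ) (hφc : HasCompactSupport φ)
    (hz : ∀ z ∈ tsupport φ, closedBall z ρ.rOut ⊆ cylinder B t₁ t₂)
    {F f : ℝ → ℝ} (hF : ∀ s, HasDerivAt F (f s) s) (hf : ContDiff ℝ 1 f) :
    ∫ z in cylinder B t₁ t₂, (-(u z) *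
        timeDeriv (mollify ρ fun y => f (mollify ρ ((cylinder B t₁ t₂).indicator u) y) * φ y) z +
        inner ℝ (a z) (spaceGradient
          (mollify ρ fun y => f (mollify ρ ((cylinder B t₁ t₂).indicator u) y) * φ y) z)) =
      -(∫ z, F (mollify ρ ((cylinder B t₁ t₂).indicator u) z) * timeDeriv φ z) +
      ∫ z, inner ℝ (mollify ρ ((cylinder B t₁ t₂).indicator a) z)
        ((deriv f (mollify ρ ((cylinder B t₁ t₂).indicator u) z) * φ z) •
            mollify ρ ((cylinder B t₁ t₂).indicator G) z +
          f (mollify ρ ((cylinder B t₁ t₂).indicator u) z) • spaceGradient φ z) := by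
  have hDm : MeasurableSet (cylinder B t₁ t₂) := (hB.prod isOpen_Ioo).measurableSet
  have hgradU : ∀ z ∈ tsupport φ, spaceGradient (mollify ρ ((cylinder B t₁ t₂).indicator u)) z =
      mollify ρ ((cylinder B t₁ t₂).indicator G) z :=
    fun z hzS => spaceGradient_mollify_indicator hB h hu hG ρ (hz z hzS)
  set D := cylinder B t₁ t₂ with hD
  have hui : Integrable (D.indicator u) := (integrable_indicator_iff hDm).2 hu
  have hai : Integrable (D.indicator a) := (integrable_indicator_iff hDm).2 ha
  set U := mollify ρ (D.indicator u) with hU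
  have hUs : ContDiff ℝ 1 U := (contDiff_mollify ρ hui.locallyIntegrable).of_le (by simp)
  have hUd : ∀ z, DifferentiableAt ℝ U z := hUs.differentiable one_ne_zero
  have hφd : ∀ z, DifferentiableAt ℝ φ z := hφ.differentiable one_ne_zero
  have hfd : ∀ s, DifferentiableAt ℝ f s := hf.differentiable one_ne_zero
  have hFs : ContDiff ℝ 1 F := contDiff_one_iff_deriv.2
    ⟨fun s => (hF s).differentiableAt, by
      rw [show deriv F = f from funext fun s => (hF s).deriv]; exact hf.continuous⟩
  set g := fun y => f (U y) * φ y with hg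
  have hgs : ContDiff ℝ 1 g := (hf.comp hUs).mul hφ
  have hgc : HasCompactSupport g := hφc.mul_left
  have hgd : ∀ z, DifferentiableAt ℝ g z := hgs.differentiable one_ne_zero
  -- derivatives of the inner test function
  have hgfd : ∀ z v, fderiv ℝ g z v =
      f (U z) * fderiv ℝ φ z v + deriv f (U z) * fderiv ℝ U z v * φ z := fun z v => by
    have h1 := (((hfd (U z)).hasDerivAt.comp_hasFDerivAt z (hUd z).hasFDerivAt).mul
      (hφd z).hasFDerivAt).fderiv
    have h2 : fderiv ℝ g z = _ := h1
    rw [h2]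
    simp
    ring
  have hsg : ∀ z, spaceGradient g z = (deriv f (U z) * φ z) • mollify ρ (D.indicator G) z +
      f (U z) • spaceGradient φ z := fun z => by
    by_cases hzS : z ∈ tsupport φ
    · rw [← hgradU z hzS]
      refine ext_inner_left ℝ fun v => ?_
      rw [inner_spaceGradient (hgd z), inner_add_right, inner_smul_right, inner_smul_right,
        inner_spaceGradient (hUd z), inner_spaceGradient (hφd z), hgfd]
      ring
    · have h0 : φ z = 0 := image_eq_zero_of_notMem_tsupport hzS
      have hgS : z ∉ tsupport g := fun hh =>
        hzS (closure_mono (Function.support_mul_subset_right _ _) hh)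
      rw [spaceGradient_eq_zero_of_notMem_tsupport hzS, h0,
        spaceGradient_eq_zero_of_notMem_tsupport hgS]
      simp
  -- the time derivative
  have htime : ∫ z, U z * timeDeriv g z = ∫ z, F (U z) * timeDeriv φ z := by
    -- the difference of the two integrands is the time derivative of `U g - F(U) φ`
    set H := fun z => U z * g z - F (U z) * φ z with hH
    have hHs : ContDiff ℝ 1 H := (hUs.mul hgs).sub ((hFs.comp hUs).mul hφ)
    have hHc : HasCompactSupport H := (hgc.mul_left (f := U)).sub
      (hφc.mul_left (f := fun z => F (U z)))
    have h0 := integral_timeDeriv_eq_zero hHs hHc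
    have h1 : ∀ z, timeDeriv H z = U z * timeDeriv g z - F (U z) * timeDeriv φ z := fun z => by
      rw [timeDeriv_eq_fderiv (hHs.differentiable one_ne_zero z), timeDeriv_eq_fderiv (hgd z),
        timeDeriv_eq_fderiv (hφd z)]
      have h1 := (((hUd z).hasFDerivAt.mul (hgd z).hasFDerivAt).sub
        (((hF (U z)).comp_hasFDerivAt z (hUd z).hasFDerivAt).mul (hφd z).hasFDerivAt)).fderiv
      have h2 : fderiv ℝ H z = _ := h1
      rw [h2]
      simp [hg]
      ring
    simp only [h1] at h0
    rw [integral_sub] at h0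
    · linarith
    · exact (hUs.continuous.mul (continuous_timeDeriv hgs)).integrable_of_hasCompactSupport
        (hasCompactSupport_timeDeriv hgc).mul_left
    · exact ((hFs.continuous.comp hUs.continuous).mul
        (continuous_timeDeriv hφ)).integrable_of_hasCompactSupport
        (hasCompactSupport_timeDeriv hφc).mul_left
  have hgt : Integrable (timeDeriv g) :=
    (continuous_timeDeriv hgs).integrable_of_hasCompactSupport (hasCompactSupport_timeDeriv hgc)
  have hgg : Integrable (spaceGradient g) :=
    (continuous_spaceGradient hgs).integrable_of_hasCompactSupport
      (hasCompactSupport_spaceGradient hgc)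
  have hηs : ContDiff ℝ 1 (mollify ρ g) :=
    (contDiff_mollify ρ hgs.continuous.locallyIntegrable).of_le (by simp)
  have hηc : HasCompactSupport (mollify ρ g) :=
    (ρ.hasCompactSupport_normed (μ := volume)).convolution _ hgc
  obtain ⟨C₁, hC₁⟩ := (continuous_timeDeriv hηs).bounded_above_of_compact_support
    (hasCompactSupport_timeDeriv hηc)
  obtain ⟨C₂, hC₂⟩ := (continuous_spaceGradient hηs).bounded_above_of_compact_support
    (hasCompactSupport_spaceGradient hηc)
  have hi1 : Integrable (fun z => D.indicator u z * timeDeriv (mollify ρ g) z) :=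
    hui.mul_bdd (c := C₁) (continuous_timeDeriv hηs).aestronglyMeasurable (Eventually.of_forall hC₁)
  have hi2 : Integrable (fun z => inner ℝ (D.indicator a z) (spaceGradient (mollify ρ g) z)) := by
    refine Integrable.mono' (hai.norm.mul_const C₂)
      (hai.1.inner (continuous_spaceGradient hηs).aestronglyMeasurable)
      (Eventually.of_forall fun z => ?_)
    exact (norm_inner_le_norm _ _).trans (mul_le_mul_of_nonneg_left (hC₂ z) (norm_nonneg _))
  calc _ = ∫ z, (-(D.indicator u z * timeDeriv (mollify ρ g) z) +
        inner ℝ (D.indicator a z) (spaceGradient (mollify ρ g) z)) := by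
        rw [← integral_indicator hDm]
        refine integral_congr_ae (Eventually.of_forall fun z => ?_)
        by_cases hzD : z ∈ D <;> simp [hzD]
    _ = -(∫ z, D.indicator u z * timeDeriv (mollify ρ g) z) +
        ∫ z, inner ℝ (D.indicator a z) (spaceGradient (mollify ρ g) z) := by
        rw [← integral_neg]
        exact integral_add hi1.neg hi2
    _ = _ := by
        rw [timeDeriv_mollify ρ hgs hgc, spaceGradient_mollify ρ hgs hgc,
          integral_inner_mollify ρ hai hgg, ← htime]
        congr 2
        · have := integral_inner_mollify ρ hui hgt
          simpa [mul_comm] using this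
        · ext z
          rw [hsg z]

/-! ### Convergence of the mollified pairings -/

section Convergence

variable {X : Type*} [MeasurableSpace X] {m : Measure X}
  {V : Type*} [NormedAddCommGroup V] [InnerProductSpace ℝ V]

theorem memLp_bdd_smul {p : ℝ≥0∞} {f : X → V} {w : X → ℝ} (hf : MemLp f p m)
    (hw : AEStronglyMeasurable w m) {C : ℝ} (hC : ∀ x, |w x| ≤ C) :
    MemLp (fun x => w x • f x) p m :=
  MemLp.smul (p := ∞) hf (memLp_top_of_bound hw C (Eventually.of_forall hC))

/-- The duality pairing of `L^p` and `L^q` is jointly continuous. -/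
theorem tendsto_integral_inner {p q : ℝ} (hpq : p.HolderConjugate q) {a : ℕ → X → V} {a₀ : X → V}
    {b : ℕ → X → V} {b₀ : X → V} (ha : ∀ i, MemLp (a i) (ENNReal.ofReal p) m)
    (ha₀ : MemLp a₀ (ENNReal.ofReal p) m) (hb : ∀ i, MemLp (b i) (ENNReal.ofReal q) m)
    (hb₀ : MemLp b₀ (ENNReal.ofReal q) m)
    (hta : Tendsto (fun i => eLpNorm (a i - a₀) (ENNReal.ofReal p) m) atTop (𝓝 0))
    (htb : Tendsto (fun i => eLpNorm (b i - b₀) (ENNReal.ofReal q) m) atTop (𝓝 0)) :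
    Tendsto (fun i => ∫ x, inner ℝ (a i x) (b i x) ∂m) atTop
      (𝓝 (∫ x, inner ℝ (a₀ x) (b₀ x) ∂m)) := by
  have h1 : Fact (1 ≤ ENNReal.ofReal p) :=
    ⟨by simpa using ENNReal.ofReal_le_ofReal hpq.lt.le⟩
  have h2 : Fact (1 ≤ ENNReal.ofReal q) :=
    ⟨by simpa using ENNReal.ofReal_le_ofReal hpq.symm.lt.le⟩
  have h3 := hpq.ennrealOfReal
  have hta' := (Lp.tendsto_Lp_iff_tendsto_eLpNorm'' a ha a₀ ha₀).2 hta
  have htb' := (Lp.tendsto_Lp_iff_tendsto_eLpNorm'' b hb b₀ hb₀).2 htb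
  obtain ⟨P, hP⟩ : ∃ P : Lp V (ENNReal.ofReal p) m →L[ℝ] Lp V (ENNReal.ofReal q) m →L[ℝ] ℝ,
      ∀ {f g : X → V} (hf : MemLp f (ENNReal.ofReal p) m) (hg : MemLp g (ENNReal.ofReal q) m),
        P (hf.toLp f) (hg.toLp g) = ∫ x, inner ℝ (f x) (g x) ∂m := by
    refine ⟨(isBoundedBilinearMap_inner (𝕜 := ℝ) (E := V)).toContinuousLinearMap.lpPairing m
      (ENNReal.ofReal p) (ENNReal.ofReal q), fun {f g} hf hg => ?_⟩
    rw [ContinuousLinearMap.lpPairing_eq_integral]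
    refine integral_congr_ae ?_
    filter_upwards [hf.coeFn_toLp, hg.coeFn_toLp] with x h1 h2
    rw [h1, h2]
    rfl
  have ht : Tendsto (fun i => P ((ha i).toLp (a i)) ((hb i).toLp (b i))) atTop
      (𝓝 (P (ha₀.toLp a₀) (hb₀.toLp b₀))) :=
    (P.continuous₂.tendsto (ha₀.toLp a₀, hb₀.toLp b₀)).comp (hta'.prodMk_nhds htb')
  rw [hP ha₀ hb₀] at ht
  exact ht.congr fun i => hP (ha i) (hb i)

/-- Uniformly convergent coefficients on `S` act continuously on an `L^p` function that vanishes off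
`S`. -/
theorem tendsto_eLpNorm_sub_smul {p : ℝ≥0∞} {S : Set X} {w : ℕ → X → ℝ} {w₀ : X → ℝ} {f : X → V}
    (hw : TendstoUniformlyOn w w₀ atTop S) (hf : MemLp f p m) (hS : ∀ x ∉ S, f x = 0) :
    Tendsto (fun i => eLpNorm (fun x => (w i x - w₀ x) • f x) p m) atTop (𝓝 0) := by
  rw [ENNReal.tendsto_atTop_zero]
  intro η hη
  have h0 : Tendsto (fun c : ℝ => ENNReal.ofReal c * eLpNorm f p m) (𝓝[>] 0) (𝓝 0) := by
    have h1 : Tendsto (fun c : ℝ => ENNReal.ofReal c) (𝓝[>] 0) (𝓝 0) := by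
      simpa using (ENNReal.continuous_ofReal.tendsto 0).mono_left nhdsWithin_le_nhds
    simpa using ENNReal.Tendsto.mul_const h1 (Or.inr hf.2.ne)
  obtain ⟨c, hc, hc0⟩ := ((h0.eventually (eventually_le_nhds hη)).and
    self_mem_nhdsWithin).exists
  obtain ⟨N, hN⟩ := eventually_atTop.1 (Metric.tendstoUniformlyOn_iff.1 hw c hc0)
  refine ⟨N, fun i hi => le_trans (eLpNorm_le_mul_eLpNorm_of_ae_le_mul
    (Eventually.of_forall fun x => ?_) p) hc⟩
  by_cases hx : x ∈ S
  · rw [norm_smul]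
    refine mul_le_mul_of_nonneg_right ?_ (norm_nonneg _)
    have := hN i hi x hx
    rw [dist_comm, Real.dist_eq] at this
    exact this.le
  · simp [hS x hx]

end Convergence

section Limit

theorem eventually_closedBall_subset {E : Type*} [NormedAddCommGroup E] [NormedSpace ℝ E]
    {S D : Set E} (hS : IsCompact S) (hD : IsOpen D)
    (hSD : S ⊆ D) {ρ : ℕ → ContDiffBump (0 : E)}
    (hρ : Tendsto (fun i => (ρ i).rOut) atTop (𝓝 0)) :
    ∀ᶠ i in atTop, ∀ z ∈ S, closedBall z (ρ i).rOut ⊆ D := by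
  obtain ⟨d, hd, hsub⟩ := hS.exists_cthickening_subset_open hD hSD
  filter_upwards [hρ.eventually (eventually_lt_nhds hd)] with i hi z hz
  exact (closedBall_subset_closedBall hi.le).trans ((closedBall_subset_cthickening hz d).trans hsub)

theorem tendstoUniformlyOn_mollify {S D : Set (SpaceTime n)} (hS : IsCompact S) (hD : IsOpen D)
    (hSD : S ⊆ D) {u : SpaceTime n → ℝ} (hDc : IsCompact (closure D))
    (hu : ContinuousOn u (closure D)) {ρ : ℕ → ContDiffBump (0 : SpaceTime n)}
    (hρ : Tendsto (fun i => (ρ i).rOut) atTop (𝓝 0)) :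
    TendstoUniformlyOn (fun i => mollify (ρ i) (D.indicator u)) (D.indicator u) atTop S := by
  rw [Metric.tendstoUniformlyOn_iff]
  intro ε hε
  obtain ⟨d, hd, hud⟩ := Metric.uniformContinuousOn_iff.1
    (hDc.uniformContinuousOn_of_continuous hu) (ε / 2) (half_pos hε)
  have hm : AEStronglyMeasurable (D.indicator u) volume :=
    (aestronglyMeasurable_indicator_iff hD.measurableSet).2
      ((hu.mono subset_closure).aestronglyMeasurable hD.measurableSet)
  filter_upwards [eventually_closedBall_subset hS hD hSD hρ,
    hρ.eventually (eventually_lt_nhds hd)] with i hi hid z hz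
  rw [dist_comm]
  refine (ContDiffBump.dist_normed_convolution_le hm fun y hy => ?_).trans_lt (half_lt_self hε)
  have hyD : y ∈ D := hi z hz (ball_subset_closedBall hy)
  rw [indicator_of_mem hyD, indicator_of_mem (hSD hz)]
  exact (hud y (subset_closure hyD) z (subset_closure (hSD hz))
    ((mem_ball.1 hy).trans hid)).le

/-- Composition with a continuous function preserves uniform convergence to a bounded limit. -/
theorem tendstoUniformlyOn_comp_of_bdd {X : Type*} {S : Set X} {w : ℕ → X → ℝ}
    {w₀ : X → ℝ} (hw : TendstoUniformlyOn w w₀ atTop S) {C : ℝ} (hC : ∀ x ∈ S, |w₀ x| ≤ C)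
    {h : ℝ → ℝ} (hh : Continuous h) :
    TendstoUniformlyOn (fun i x => h (w i x)) (fun x => h (w₀ x)) atTop S := by
  have hK : UniformContinuousOn h (Icc (-(C + 1)) (C + 1)) :=
    isCompact_Icc.uniformContinuousOn_of_continuous hh.continuousOn
  refine hK.comp_tendstoUniformlyOn_eventually ?_ ?_ hw
  · filter_upwards [Metric.tendstoUniformlyOn_iff.1 hw 1 one_pos] with i hi x hx
    have h1 := hi x hx
    rw [Real.dist_eq, abs_lt] at h1
    have h2 := abs_le.1 (hC x hx)
    constructor <;> linarith
  · intro x hx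
    have h2 := abs_le.1 (hC x hx)
    constructor <;> linarith

/-- Passage to the limit in the tested equation as the mollification radius tends to `0`. -/
theorem tendsto_mollified_test {p q : ℝ} (hpq : p.HolderConjugate q) {D : Set (SpaceTime n)}
    (hD : IsOpen D) (hDc : IsCompact (closure D)) {u : SpaceTime n → ℝ}
    (hu : ContinuousOn u (closure D)) {G a : SpaceTime n → Space n}
    (hG : MemLp G (ENNReal.ofReal p) (volume.restrict D))
    (ha : MemLp a (ENNReal.ofReal q) (volume.restrict D))
    {φ : SpaceTime n → ℝ} (hφ : ContDiff ℝ 1 φ) (hφc : HasCompactSupport φ)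
    (hφD : tsupport φ ⊆ D) {F f : ℝ → ℝ} (hF : Continuous F) (hf : ContDiff ℝ 1 f)
    {ρ : ℕ → ContDiffBump (0 : SpaceTime n)}
    (hρ : Tendsto (fun i => (ρ i).rOut) atTop (𝓝 0)) :
    Tendsto (fun i => -(∫ z, F (mollify (ρ i) (D.indicator u) z) * timeDeriv φ z) +
      ∫ z, inner ℝ (mollify (ρ i) (D.indicator a) z)
        ((deriv f (mollify (ρ i) (D.indicator u) z) * φ z) • mollify (ρ i) (D.indicator G) z +
          f (mollify (ρ i) (D.indicator u) z) • spaceGradient φ z)) atTop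
      (𝓝 (-(∫ z in D, F (u z) * timeDeriv φ z) +
        ∫ z in D, inner ℝ (a z)
          ((deriv f (u z) * φ z) • G z + f (u z) • spaceGradient φ z))) := by
  have hDm := hD.measurableSet
  have hpq' := hpq.symm
  have hf' : Continuous (deriv f) := hf.continuous_deriv le_rfl
  set u₀ := D.indicator u with hu₀
  set G₀ := D.indicator G with hG₀
  set a₀ := D.indicator a with ha₀
  obtain ⟨C, hC⟩ : ∃ C, ∀ z ∈ closure D, ‖u z‖ ≤ C := hDc.exists_bound_of_continuousOn hu
  have hum : AEStronglyMeasurable u₀ volume :=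
    (aestronglyMeasurable_indicator_iff hDm).2
      ((hu.mono subset_closure).aestronglyMeasurable hDm)
  have hub : ∀ z ∈ tsupport φ, |u₀ z| ≤ C := fun z hz => by
    rw [hu₀, indicator_of_mem (hφD hz)]
    exact hC z (subset_closure (hφD hz))
  have hub' : ∀ z, |u₀ z| ≤ max C 0 := fun z => by
    by_cases hz : z ∈ D
    · rw [hu₀, indicator_of_mem hz]; exact (hC z (subset_closure hz)).trans (le_max_left _ _)
    · rw [hu₀, indicator_of_notMem hz]; simp
  have hul : LocallyIntegrable u₀ volume := by
    refine MemLp.locallyIntegrable (p := ∞) ?_ le_top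
    exact memLp_top_of_bound hum _ (Eventually.of_forall hub')
  have hGL : MemLp G₀ (ENNReal.ofReal p) volume := (memLp_indicator_iff_restrict hDm).2 hG
  have haL : MemLp a₀ (ENNReal.ofReal q) volume := (memLp_indicator_iff_restrict hDm).2 ha
  have hUc : ∀ i, Continuous (mollify (ρ i) u₀) := fun i =>
    (contDiff_mollify (ρ i) hul).continuous
  have hunif := tendstoUniformlyOn_mollify hφc.isCompact hD hφD hDc hu hρ
  have hcomp : ∀ {h : ℝ → ℝ}, Continuous h → TendstoUniformlyOn
      (fun i z => h (mollify (ρ i) u₀ z)) (fun z => h (u₀ z)) atTop (tsupport φ) :=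
    fun hh => tendstoUniformlyOn_comp_of_bdd hunif hub hh
  -- bounded compositions
  have hbd : ∀ {h : ℝ → ℝ}, Continuous h → ∃ K, 0 ≤ K ∧ ∀ z, |h (u₀ z)| ≤ K := fun {h} hh => by
    obtain ⟨K, hK⟩ := (isCompact_Icc (a := -(max C 0)) (b := max C 0)).exists_bound_of_continuousOn
      hh.continuousOn
    refine ⟨max K 0, le_max_right _ _, fun z => ?_⟩
    exact (hK _ (abs_le.1 (hub' z))).trans (le_max_left _ _)
  obtain ⟨Cφ, hCφ⟩ := hφ.continuous.bounded_above_of_compact_support hφc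
  have hCφ0 : 0 ≤ Cφ := (norm_nonneg _).trans (hCφ 0)
  have hgφ : MemLp (spaceGradient φ) (ENNReal.ofReal p) volume :=
    (continuous_spaceGradient hφ).memLp_of_hasCompactSupport (hasCompactSupport_spaceGradient hφc)
  refine Tendsto.add (Tendsto.neg ?_) ?_
  · -- the time term
    have htφ : Integrable (timeDeriv φ) :=
      (continuous_timeDeriv hφ).integrable_of_hasCompactSupport (hasCompactSupport_timeDeriv hφc)
    obtain ⟨K, hK0, hK⟩ := hbd hF
    have e : ∫ z in D, F (u z) * timeDeriv φ z = ∫ z, F (u₀ z) * timeDeriv φ z := by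
      rw [← integral_indicator hDm]
      refine integral_congr_ae (Eventually.of_forall fun z => ?_)
      by_cases hz : z ∈ D
      · simp [hz, hu₀]
      · simp [hz, timeDeriv_eq_zero_of_notMem_tsupport fun h => hz (hφD h)]
    rw [e]
    refine tendsto_integral_of_L1' _ ?_ (Eventually.of_forall fun i => ?_) ?_
    · exact (hF.comp_aestronglyMeasurable hum).mul htφ.1
    · exact ((hF.comp (hUc i)).mul (continuous_timeDeriv hφ)).integrable_of_hasCompactSupport
        (hasCompactSupport_timeDeriv hφc).mul_left
    · refine (tendsto_eLpNorm_sub_smul (p := 1) (f := timeDeriv φ) (hcomp hF)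
        (memLp_one_iff_integrable.2 htφ)
        fun z hz => timeDeriv_eq_zero_of_notMem_tsupport hz).congr fun i => ?_
      congr 1
      ext z
      simp [sub_mul]
  · -- the space term
    obtain ⟨K, hK0, hK⟩ := hbd hf'
    obtain ⟨K', hK0', hK'⟩ := hbd hf.continuous
    set b : ℕ → SpaceTime n → Space n := fun i z =>
      (deriv f (mollify (ρ i) u₀ z) * φ z) • mollify (ρ i) G₀ z +
        f (mollify (ρ i) u₀ z) • spaceGradient φ z with hb
    set b₀ : SpaceTime n → Space n := fun z =>
      (deriv f (u₀ z) * φ z) • G₀ z + f (u₀ z) • spaceGradient φ z with hb₀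
    have e : ∫ z in D, inner ℝ (a z) ((deriv f (u z) * φ z) • G z + f (u z) • spaceGradient φ z) =
        ∫ z, inner ℝ (a₀ z) (b₀ z) := by
      rw [← integral_indicator hDm]
      refine integral_congr_ae (Eventually.of_forall fun z => ?_)
      by_cases hz : z ∈ D <;> simp [hz, hu₀, hG₀, ha₀, hb₀]
    rw [e]
    have hGj : ∀ i, MemLp (mollify (ρ i) G₀) (ENNReal.ofReal p) volume := fun i =>
      memLp_normed_convolution hpq.lt.le hGL (ρ i)
    have haj : ∀ i, MemLp (mollify (ρ i) a₀) (ENNReal.ofReal q) volume := fun i =>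
      memLp_normed_convolution hpq'.lt.le haL (ρ i)
    have hbj : ∀ i, MemLp (b i) (ENNReal.ofReal p) volume := fun i => by
      have hc1 : Continuous fun z => deriv f (mollify (ρ i) u₀ z) * φ z :=
        (hf'.comp (hUc i)).mul hφ.continuous
      obtain ⟨K₁, hK₁⟩ := hc1.bounded_above_of_compact_support hφc.mul_left
      have hc2 : Continuous fun z => f (mollify (ρ i) u₀ z) • spaceGradient φ z :=
        (hf.continuous.comp (hUc i)).smul (continuous_spaceGradient hφ)
      have m1 := memLp_bdd_smul (hGj i) hc1.aestronglyMeasurable hK₁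
      have m2 : MemLp (fun z => f (mollify (ρ i) u₀ z) • spaceGradient φ z) (ENNReal.ofReal p)
          volume := hc2.memLp_of_hasCompactSupport (HasCompactSupport.intro hφc fun z hz => by
        rw [spaceGradient_eq_zero_of_notMem_tsupport hz, smul_zero])
      exact m1.add m2
    have hφG : MemLp (fun z => φ z • G₀ z) (ENNReal.ofReal p) volume :=
      memLp_bdd_smul hGL hφ.continuous.aestronglyMeasurable hCφ
    have hb₀L : MemLp b₀ (ENNReal.ofReal p) volume := by
      refine MemLp.add ?_ ?_
      · simp only [mul_smul]
        exact memLp_bdd_smul hφG (hf'.comp_aestronglyMeasurable hum) hK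
      · exact memLp_bdd_smul hgφ (hf.continuous.comp_aestronglyMeasurable hum) hK'
    refine tendsto_integral_inner hpq' haj haL hbj hb₀L
      (tendsto_eLpNorm_normed_convolution_sub hpq'.lt.le haL hρ) ?_
    have t1 := tendsto_eLpNorm_normed_convolution_sub hpq.lt.le hGL hρ
    have t2 := tendsto_eLpNorm_sub_smul (hcomp hf') hφG fun z hz => by
      rw [image_eq_zero_of_notMem_tsupport hz, zero_smul]
    have t3 := tendsto_eLpNorm_sub_smul (hcomp hf.continuous) hgφ fun z hz =>
      spaceGradient_eq_zero_of_notMem_tsupport hz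
    have hp1 : 1 ≤ ENNReal.ofReal p := by simpa using ENNReal.ofReal_le_ofReal hpq.lt.le
    have tsum := ((ENNReal.Tendsto.const_mul t1
      (Or.inr (ENNReal.ofReal_ne_top (r := (K + 1) * Cφ)))).add t2).add t3
    simp only [mul_zero, add_zero] at tsum
    refine tendsto_of_tendsto_of_tendsto_of_le_of_le' tendsto_const_nhds tsum
      (Eventually.of_forall fun i => zero_le) ?_
    filter_upwards [Metric.tendstoUniformlyOn_iff.1 (hcomp hf') 1 one_pos] with i hi
    -- three differences: of the gradients, and of the two coefficients that depend on `u`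
    have hdec : b i - b₀ = ((fun z => (deriv f (mollify (ρ i) u₀ z) * φ z) •
        (mollify (ρ i) G₀ - G₀) z) +
        fun z => (deriv f (mollify (ρ i) u₀ z) - deriv f (u₀ z)) • φ z • G₀ z) +
        fun z => (f (mollify (ρ i) u₀ z) - f (u₀ z)) • spaceGradient φ z := by
      ext1 z
      simp only [hb, hb₀, Pi.sub_apply, Pi.add_apply]
      module
    have hmU : AEStronglyMeasurable (mollify (ρ i) u₀) volume := (hUc i).aestronglyMeasurable
    have m1 : AEStronglyMeasurable (fun z => (deriv f (mollify (ρ i) u₀ z) * φ z) •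
        (mollify (ρ i) G₀ - G₀) z) volume :=
      ((hf'.comp_aestronglyMeasurable hmU).mul hφ.continuous.aestronglyMeasurable).smul
        ((hGj i).1.sub hGL.1)
    have m2 : AEStronglyMeasurable (fun z => (deriv f (mollify (ρ i) u₀ z) - deriv f (u₀ z)) •
        φ z • G₀ z) volume :=
      ((hf'.comp_aestronglyMeasurable hmU).sub (hf'.comp_aestronglyMeasurable hum)).smul hφG.1
    have m3 : AEStronglyMeasurable (fun z => (f (mollify (ρ i) u₀ z) - f (u₀ z)) •
        spaceGradient φ z) volume :=
      ((hf.continuous.comp_aestronglyMeasurable hmU).sub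
        (hf.continuous.comp_aestronglyMeasurable hum)).smul hgφ.1
    rw [hdec]
    refine (eLpNorm_add_le (m1.add m2) m3 hp1).trans (add_le_add_left
      ((eLpNorm_add_le m1 m2 hp1).trans (add_le_add_left ?_ _)) _)
    refine eLpNorm_le_mul_eLpNorm_of_ae_le_mul (Eventually.of_forall fun z => ?_) _
    rw [norm_smul]
    refine mul_le_mul_of_nonneg_right ?_ (norm_nonneg _)
    by_cases hz : z ∈ tsupport φ
    · rw [norm_mul]
      refine mul_le_mul ?_ (hCφ z) (norm_nonneg _) (by positivity)
      have h1 := hi z hz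
      rw [dist_comm, Real.dist_eq] at h1
      have h2 := hK z
      have h3 := abs_sub_abs_le_abs_sub (deriv f (mollify (ρ i) u₀ z)) (deriv f (u₀ z))
      rw [Real.norm_eq_abs]
      linarith
    · rw [image_eq_zero_of_notMem_tsupport hz]
      simp only [mul_zero, norm_zero]
      positivity

end Limit

/-! ### Weak gradients and Carathéodory functions -/

theorem restrict_cylinder (B : Set (Space n)) (t₁ t₂ : ℝ) :
    (volume : Measure (SpaceTime n)).restrict (cylinder B t₁ t₂) =
      ((volume : Measure (Space n)).restrict B).prod
        ((volume : Measure ℝ).restrict (Ioo t₁ t₂)) := by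
  rw [cylinder, Measure.volume_eq_prod, Measure.prod_restrict]

theorem locallyIntegrableOn_of_memLp_restrict {B : Set (Space n)} (hB : IsOpen B)
    {V : Type*} [NormedAddCommGroup V] {g : Space n → V} {q : ℝ≥0∞} (hq : 1 ≤ q)
    (hg : MemLp g q (volume.restrict B)) : LocallyIntegrableOn g B := by
  rw [locallyIntegrableOn_iff hB.isLocallyClosed]
  intro K hKB hK
  have : IsFiniteMeasure ((volume : Measure (Space n)).restrict K) :=
    isFiniteMeasure_restrict.2 hK.measure_lt_top.ne
  exact (hg.mono_measure (Measure.restrict_mono hKB le_rfl)).integrable hq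

/-- Weak spatial gradients are unique, also for different integrability exponents. -/
theorem HasParabolicGradient.ae_eq {q₁ q₂ : ℝ} (hq₁ : 1 ≤ q₁) (hq₂ : 1 ≤ q₂) {B : Set (Space n)}
    {t₁ t₂ : ℝ} (hB : IsOpen B) {u : SpaceTime n → ℝ} {G₁ G₂ : SpaceTime n → Space n}
    (h₁ : HasParabolicGradient q₁ B t₁ t₂ u G₁) (h₂ : HasParabolicGradient q₂ B t₁ t₂ u G₂) :
    G₁ =ᵐ[volume.restrict (cylinder B t₁ t₂)] G₂ := by
  have hm := h₁.aestronglyMeasurable_grad.sub h₂.aestronglyMeasurable_grad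
  have h1' : 1 ≤ ENNReal.ofReal q₁ := by simpa using ENNReal.ofReal_le_ofReal hq₁
  have h2' : 1 ≤ ENNReal.ofReal q₂ := by simpa using ENNReal.ofReal_le_ofReal hq₂
  have h0 : ∫⁻ z in cylinder B t₁ t₂, ‖(G₁ - G₂) z‖ₑ = 0 := by
    rw [restrict_cylinder] at hm ⊢
    rw [lintegral_prod_symm _ hm.enorm]
    refine (lintegral_congr_ae ?_).trans lintegral_zero
    filter_upwards [h₁.slice, h₂.slice] with t s₁ s₂
    refine (lintegral_congr_ae ?_).trans lintegral_zero
    have l₁ : LocallyIntegrableOn (fun x => G₁ (x, t)) B :=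
      locallyIntegrableOn_of_memLp_restrict hB h1' s₁.memLp_grad
    have l₂ : LocallyIntegrableOn (fun x => G₂ (x, t)) B :=
      locallyIntegrableOn_of_memLp_restrict hB h2' s₂.memLp_grad
    have key := hB.ae_eq_zero_of_integral_contDiff_smul_eq_zero (l₁.sub l₂) fun χ hχ hχc hχB => by
      have ht : IsTestFunction B χ := ⟨hχ, hχc, hχB⟩
      have e₁ := s₁.integral_eq χ ht
      have e₂ := s₂.integral_eq χ ht
      rw [e₁, neg_inj] at e₂
      have i : ∀ {g : Space n → Space n}, LocallyIntegrableOn g B →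
          Integrable (fun x => χ x • g x) := fun {g} hg => by
        have hK : IntegrableOn g (tsupport χ) := hg.integrableOn_compact_subset hχB hχc.isCompact
        obtain ⟨C, hC⟩ := hχ.continuous.bounded_above_of_compact_support hχc
        have hK' : IntegrableOn (fun x => χ x • g x) (tsupport χ) :=
          Integrable.bdd_smul hK C hχ.continuous.aestronglyMeasurable (Eventually.of_forall hC)
        refine (integrableOn_iff_integrable_of_support_subset fun x hx => ?_).1 hK'
        by_contra h
        exact hx (by simp [image_eq_zero_of_notMem_tsupport h])
      have e : ∀ g : Space n → Space n, ∫ x in B, χ x • g x = ∫ x, χ x • g x := fun g => by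
        rw [setIntegral_eq_integral_of_forall_compl_eq_zero]
        intro x hx
        rw [image_eq_zero_of_notMem_tsupport fun h => hx (hχB h), zero_smul]
      rw [e, e] at e₂
      simp only [Pi.sub_apply, smul_sub]
      rw [integral_sub (i l₁) (i l₂), e₂, sub_self]
    rw [← ae_restrict_iff' hB.measurableSet] at key
    filter_upwards [key] with x hx
    simpa using hx
  rw [lintegral_eq_zero_iff' hm.enorm] at h0
  filter_upwards [h0] with z hz
  simpa [sub_eq_zero] using hz

theorem HasParabolicGradient.memLp {q : ℝ} (hq : 0 < q) {B : Set (Space n)} {t₁ t₂ : ℝ}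
    {u : SpaceTime n → ℝ} {G : SpaceTime n → Space n} (h : HasParabolicGradient q B t₁ t₂ u G) :
    MemLp G (ENNReal.ofReal q) (volume.restrict (cylinder B t₁ t₂)) := by
  refine ⟨h.aestronglyMeasurable_grad, ?_⟩
  rw [eLpNorm_lt_top_iff_lintegral_rpow_enorm_lt_top (by simpa using hq) ENNReal.ofReal_ne_top,
    ENNReal.toReal_ofReal hq.le]
  have hm := h.aestronglyMeasurable_grad
  rw [restrict_cylinder] at hm ⊢
  rw [lintegral_prod_symm _ (hm.enorm.pow_const q)]
  exact (lintegral_mono fun t => lintegral_mono fun x => le_add_self).trans_lt h.lintegral_lt_top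

/-- Superposition of a Carathéodory function with a measurable function is measurable. -/
theorem aestronglyMeasurable_caratheodory {X V : Type*} [MeasurableSpace X] {m : Measure X}
    [NormedAddCommGroup V] [MeasurableSpace V] [BorelSpace V] [SecondCountableTopology V]
    {A : X → V → V} (hA : ∀ ξ, AEMeasurable (fun x => A x ξ) m)
    (hc : ∀ᵐ x ∂m, Continuous (A x)) {g : X → V} (hg : AEStronglyMeasurable g m) :
    AEStronglyMeasurable (fun x => A x (g x)) m := by
  obtain ⟨g', hg', hgg'⟩ := hg
  have hs : ∀ s : SimpleFunc X V, AEMeasurable (fun x => A x (s x)) m := fun s => by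
    have e : (fun x => A x (s x)) =
        fun x => ∑ ξ ∈ s.range, (s ⁻¹' {ξ}).indicator (fun x => A x ξ) x := by
      ext1 x
      rw [Finset.sum_eq_single (s x)]
      · simp
      · intro ξ _ hne
        exact indicator_of_notMem (fun h => hne h.symm) _
      · intro h
        exact absurd (s.mem_range_self x) h
    rw [e]
    exact Finset.aemeasurable_fun_sum _ fun ξ _ =>
      (hA ξ).indicator (s.measurableSet_fiber ξ)
  have hl : AEMeasurable (fun x => A x (g' x)) m := by
    refine aemeasurable_of_tendsto_metrizable_ae atTop (fun k => hs (hg'.approx k)) ?_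
    filter_upwards [hc] with x hx
    exact (hx.tendsto _).comp (hg'.tendsto_approx x)
  refine (hl.congr ?_).aestronglyMeasurable
  filter_upwards [hgg'] with x hx
  rw [hx]

/-! ### The Riesz measure off the contact set -/

theorem weakForm_eq_of_subset {A : SpaceTime n → Space n → Space n} {N U : Set (SpaceTime n)}
    (hU : MeasurableSet U) (hNU : N ⊆ U) {u : SpaceTime n → ℝ} {G : SpaceTime n → Space n}
    {φ : SpaceTime n → ℝ} (hφ : tsupport φ ⊆ N) : weakForm A U u G φ = weakForm A N u G φ := by
  refine setIntegral_eq_of_subset_of_forall_sdiff_eq_zero hU hNU fun z hz => ?_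
  have h : z ∉ tsupport φ := fun h => hz.2 (hφ h)
  rw [timeDeriv_eq_zero_of_notMem_tsupport h, spaceGradient_eq_zero_of_notMem_tsupport h]
  simp

theorem weakForm_congr {A : SpaceTime n → Space n → Space n} {N : Set (SpaceTime n)}
    {u : SpaceTime n → ℝ} {G₁ G₂ : SpaceTime n → Space n} (h : G₁ =ᵐ[volume.restrict N] G₂)
    (φ : SpaceTime n → ℝ) : weakForm A N u G₁ φ = weakForm A N u G₂ φ := by
  refine integral_congr_ae ?_
  filter_upwards [h] with z hz
  rw [hz]

theorem IsRadonOn.integrableOn {U : Set (SpaceTime n)} {μ : Measure (SpaceTime n)}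
    (hμ : IsRadonOn U μ) {φ : SpaceTime n → ℝ} (hφ : Continuous φ) (hc : HasCompactSupport φ)
    (hU : tsupport φ ⊆ U) : Integrable φ (μ.restrict U) := by
  have h1 : IntegrableOn φ (tsupport φ) (μ.restrict U) := by
    obtain ⟨C, hC⟩ := hφ.bounded_above_of_compact_support hc
    refine IntegrableOn.of_bound ?_ hφ.aestronglyMeasurable C (Eventually.of_forall hC)
    exact (Measure.restrict_apply_le _ _).trans_lt (hμ _ hc.isCompact hU)
  exact (integrableOn_iff_integrable_of_support_subset (subset_tsupport φ)).1 h1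

/-- The Riesz measure does not charge the open set where the obstacle is not touched, since `u` is a
solution there. -/
theorem measure_eq_zero_of_isWeakSolution {p : ℝ} (hp : 2 ≤ p)
    {A : SpaceTime n → Space n → Space n} {U W : Set (SpaceTime n)} (hU : IsOpen U)
    (hW : IsOpen W) (hWU : W ⊆ U) {u : SpaceTime n → ℝ} {μ : Measure (SpaceTime n)}
    (hμ : IsRieszMeasure p A U u μ) (hu : IsWeakSolution p A W u) : μ W = 0 := by
  obtain ⟨hR, G, hG, hGμ⟩ := hμ
  obtain ⟨G', hG', hG'u⟩ := hu
  refine measure_null_of_locally_null W fun z hz => ?_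
  obtain ⟨ε, hε, hεW⟩ := Metric.nhds_basis_closedBall.mem_iff.1 (hW.mem_nhds hz)
  have hN : ball z ε = cylinder (ball z.1 ε) (z.2 - ε) (z.2 + ε) := by
    rw [cylinder, ← Real.ball_eq_Ioo, ball_prod_same]
  have hcl : closure (ball z ε) ⊆ closedBall z ε := closure_ball_subset_closedBall
  have hcc : IsCompact (closure (ball z ε)) :=
    (isCompact_closedBall z ε).of_isClosed_subset isClosed_closure hcl
  have hNW : CompactlyContained (cylinder (ball z.1 ε) (z.2 - ε) (z.2 + ε)) W := by
    rw [← hN]; exact ⟨hcc, hcl.trans hεW⟩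
  have hNU : CompactlyContained (cylinder (ball z.1 ε) (z.2 - ε) (z.2 + ε)) U :=
    ⟨hNW.1, hNW.2.trans hWU⟩
  have hsub : cylinder (ball z.1 ε) (z.2 - ε) (z.2 + ε) ⊆ U := subset_closure.trans hNU.2
  let φ : ContDiffBump z := ⟨ε / 4, ε / 2, by positivity, by linarith⟩
  have hφN : tsupport φ ⊆ cylinder (ball z.1 ε) (z.2 - ε) (z.2 + ε) := by
    rw [φ.tsupport_eq, ← hN]
    exact closedBall_subset_ball (half_lt_self hε)
  have h1 := hG'u _ _ _ isOpen_ball hNW φ ⟨φ.contDiff, φ.hasCompactSupport, hφN⟩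
  have h2 := hGμ φ ⟨φ.contDiff, φ.hasCompactSupport, hφN.trans hsub⟩
  have hGG' := (hG _ _ _ isOpen_ball hNU).ae_eq (by linarith) (by linarith) isOpen_ball
    (hG' _ _ _ isOpen_ball hNW)
  rw [weakForm_eq_of_subset hU.measurableSet hsub hφN, weakForm_congr hGG', h1] at h2
  have h3 := (integral_eq_zero_iff_of_nonneg (fun z => φ.nonneg)
    (hR.integrableOn φ.continuous φ.hasCompactSupport (hφN.trans hsub))).1 h2.symm
  rw [EventuallyEq, ae_restrict_iff' hU.measurableSet] at h3
  refine ⟨ball z (ε / 4), mem_nhdsWithin_of_mem_nhds (ball_mem_nhds z (by positivity)), ?_⟩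
  refine measure_mono_null (fun y hy => ?_) h3
  have hyU : y ∈ U := hWU (hεW (ball_subset_closedBall (ball_subset_ball (by linarith) hy)))
  have : φ y = 1 := φ.one_of_mem_closedBall (ball_subset_closedBall hy)
  simp [hyU, this]

/-! ### The tested equation in the limit -/

/-- The tested equation in the limit. On the set `E`, where `φ = 1` up to a distance `s`, the limit
of the test functions is at least `2c`; by uniform convergence they are eventually at least `c`, so
the left-hand side controls the mass of `E`. -/
theorem mul_measure_le_of_isRieszMeasure {p ν L : ℝ} (hp : 2 ≤ p)
    {A : SpaceTime n → Space n → Space n} {U : Set (SpaceTime n)} (hU : IsOpen U)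
    (hA : IsAdmissibleOperator p ν L U A) {u : SpaceTime n → ℝ} {μ : Measure (SpaceTime n)}
    (hμ : IsRieszMeasure p A U u μ) {B : Set (Space n)} {t₁ t₂ : ℝ} (hB : IsOpen B)
    (hDU : CompactlyContained (cylinder B t₁ t₂) U) {G : SpaceTime n → Space n}
    (hG : HasParabolicGradient p B t₁ t₂ u G) (hu : ContinuousOn u (closure (cylinder B t₁ t₂)))
    {φ : SpaceTime n → ℝ} (hφ : IsTestFunction (cylinder B t₁ t₂) φ) (hφ0 : ∀ z, 0 ≤ φ z)
    {F f : ℝ → ℝ} (hF : ∀ s, HasDerivAt F (f s) s) (hf : ContDiff ℝ 1 f) (hf0 : ∀ s, 0 ≤ f s)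
    {E : Set (SpaceTime n)} {c s : ℝ} (hs : 0 < s) (hc : 0 < c)
    (hE : ∀ y ∈ E, 2 * c ≤ f (u y) ∧ ∀ z ∈ ball y s, φ z = 1) :
    c * μ.real E ≤ -(∫ z in cylinder B t₁ t₂, F (u z) * timeDeriv φ z) +
      ∫ z in cylinder B t₁ t₂, inner ℝ (A z (G z))
        ((deriv f (u z) * φ z) • G z + f (u z) • spaceGradient φ z) := by
  have hp0 : 0 < p := by linarith
  have hpq : p.HolderConjugate (p / (p - 1)) := Real.HolderConjugate.conjExponent (by linarith)
  have hDo : IsOpen (cylinder B t₁ t₂) := hB.prod isOpen_Ioo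
  obtain ⟨hR, G', hG', hGμ⟩ := hμ
  have hGG' := (hG' _ _ _ hB hDU).ae_eq (by linarith) (by linarith) hB hG
  have hGp := hG.memLp hp0
  set D := cylinder B t₁ t₂ with hD
  have hDsub : D ⊆ U := subset_closure.trans hDU.2
  have hfin : IsFiniteMeasure ((volume : Measure (SpaceTime n)).restrict D) :=
    isFiniteMeasure_restrict.2
      ((measure_mono subset_closure).trans_lt hDU.1.measure_lt_top).ne
  set a : SpaceTime n → Space n := fun z => A z (G z) with ha
  have hap : MemLp a (ENNReal.ofReal (p / (p - 1))) (volume.restrict D) := by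
    have h1 : MemLp (fun z => ‖G z‖ ^ (p - 1)) (ENNReal.ofReal (p / (p - 1)))
        (volume.restrict D) := by
      have h := hGp.norm_rpow_div (ENNReal.ofReal (p - 1))
      rwa [ENNReal.toReal_ofReal (by linarith), ← ENNReal.ofReal_div_of_pos (by linarith)] at h
    refine h1.of_le_mul (c := L) ?_ ?_
    · refine aestronglyMeasurable_caratheodory (fun ξ => ?_) ?_ hGp.1
      · exact (hA.aemeasurable ξ).mono_measure (Measure.restrict_mono hDsub le_rfl)
      · exact ae_restrict_of_ae_restrict_of_subset hDsub hA.continuous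
    · filter_upwards [ae_restrict_of_ae_restrict_of_subset hDsub hA.growth] with z hz
      rw [Real.norm_of_nonneg (by positivity)]
      exact hz _
  have hGi : IntegrableOn G D := hGp.integrable (by
    simpa using ENNReal.ofReal_le_ofReal hpq.lt.le)
  have hai : IntegrableOn a D := hap.integrable (by
    simpa using ENNReal.ofReal_le_ofReal hpq.symm.lt.le)
  have hui : IntegrableOn u D := (hu.integrableOn_compact hDU.1).mono_set subset_closure
  have hφs : ContDiff ℝ 1 φ := hφ.1.of_le (by simp)
  have hFc : Continuous F := continuous_iff_continuousAt.2 fun s => (hF s).continuousAt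
  let ρ : ℕ → ContDiffBump (0 : SpaceTime n) := fun i =>
    ⟨1 / ((i : ℝ) + 1) / 2, 1 / ((i : ℝ) + 1), by positivity, half_lt_self (by positivity)⟩
  have hρ : Tendsto (fun i => (ρ i).rOut) atTop (𝓝 0) := tendsto_one_div_add_atTop_nhds_zero_nat
  have hlim := tendsto_mollified_test hpq hDo hDU.1 hu hGp hap hφs hφ.2.1 hφ.2.2 hFc hf hρ
  refine ge_of_tendsto hlim ?_
  -- uniform closeness of `f` along the mollifications
  obtain ⟨C, hC⟩ : ∃ C, ∀ z ∈ closure D, ‖u z‖ ≤ C := hDU.1.exists_bound_of_continuousOn hu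
  have hunif := tendstoUniformlyOn_comp_of_bdd
    (tendstoUniformlyOn_mollify hφ.2.1.isCompact hDo hφ.2.2 hDU.1 hu hρ) (C := C) (fun z hz => by
      rw [indicator_of_mem (hφ.2.2 hz)]; exact hC z (subset_closure (hφ.2.2 hz))) hf.continuous
  obtain ⟨d, hd, hfd⟩ := Metric.uniformContinuousOn_iff.1
    (hDU.1.uniformContinuousOn_of_continuous (hf.continuous.comp_continuousOn hu)) (c / 2)
    (half_pos hc)
  filter_upwards [eventually_closedBall_subset hφ.2.1.isCompact hDo hφ.2.2 hρ,
    hρ.eventually (eventually_lt_nhds hd), hρ.eventually (eventually_lt_nhds hs),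
    Metric.tendstoUniformlyOn_iff.1 hunif (c / 2) (half_pos hc)] with i hball hid his hclose
  rw [← integral_mollified_test hB hG hui hGi hai (ρ i) hφs hφ.2.1 hball hF hf]
  set g : SpaceTime n → ℝ := fun y => f (mollify (ρ i) (D.indicator u) y) * φ y with hg
  have hUc : Continuous (mollify (ρ i) (D.indicator u)) :=
    (contDiff_mollify (ρ i)
      ((integrable_indicator_iff hDo.measurableSet).2 hui).locallyIntegrable).continuous
  have hgc : Continuous g := (hf.continuous.comp hUc).mul hφs.continuous
  have hgcs : HasCompactSupport g := hφ.2.1.mul_left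
  have hg0 : ∀ y, 0 ≤ g y := fun y => mul_nonneg (hf0 _) (hφ0 y)
  have hηc : ContDiff ℝ ∞ (mollify (ρ i) g) := contDiff_mollify (ρ i) hgc.locallyIntegrable
  have hηcs : HasCompactSupport (mollify (ρ i) g) :=
    ((ρ i).hasCompactSupport_normed (μ := volume)).convolution _ hgcs
  have hηD : tsupport (mollify (ρ i) g) ⊆ D := by
    have hK : IsCompact (closedBall (0 : SpaceTime n) (ρ i).rOut + tsupport φ) :=
      (isCompact_closedBall _ _).add hφ.2.1.isCompact
    refine (closure_minimal (fun z hz => ?_) hK.isClosed).trans ?_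
    · obtain ⟨t, ht, y, hy, rfl⟩ := support_convolution_subset _ hz
      refine add_mem_add ?_ (subset_tsupport _ (Function.support_mul_subset_right _ _ hy))
      rw [(ρ i).support_normed_eq] at ht
      exact ball_subset_closedBall ht
    · rintro _ ⟨t, ht, y, hy, rfl⟩
      refine hball y hy ?_
      simpa [mem_closedBall, dist_eq_norm] using ht
  have hηlow : ∀ y ∈ E, c ≤ mollify (ρ i) g y := fun y hy => by
    refine le_mollify (ρ i) hgc fun z hz => ?_
    have hts : ∀ w ∈ ball y s, w ∈ tsupport φ := fun w hw =>
      subset_tsupport _ (by simp [(hE y hy).2 w hw])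
    have hzs : z ∈ ball y s := ball_subset_ball his.le hz
    have hzt := hts z hzs
    have hyt := hts y (mem_ball_self hs)
    have h1 := hclose z hzt
    have h2 := hfd z (subset_closure (hφ.2.2 hzt)) y (subset_closure (hφ.2.2 hyt))
      ((mem_ball.1 hz).trans hid)
    rw [indicator_of_mem (hφ.2.2 hzt), Real.dist_eq, abs_lt] at h1
    simp only [Function.comp, Real.dist_eq] at h2
    rw [abs_lt] at h2
    have h3 := (hE y hy).1
    simp only [hg, (hE y hy).2 z hzs, mul_one]
    linarith [h1.1, h1.2, h2.1, h2.2]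
  have hw : weakForm A U u G' (mollify (ρ i) g) = weakForm A D u G (mollify (ρ i) g) := by
    rw [weakForm_eq_of_subset hU.measurableSet hDsub hηD, weakForm_congr hGG']
  rw [hGμ _ ⟨hηc, hηcs, hηD.trans hDsub⟩] at hw
  refine le_trans ?_ hw.le
  have hηint := hR.integrableOn hηc.continuous hηcs (hηD.trans hDsub)
  -- Markov's inequality for the smooth test function
  refine le_trans ?_ (mul_meas_ge_le_integral_of_nonneg
    (Eventually.of_forall fun z => mollify_nonneg (ρ i) hg0 z) hηint c)
  refine mul_le_mul_of_nonneg_left ?_ hc.le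
  have hsup : {z | c ≤ mollify (ρ i) g z} ⊆ tsupport (mollify (ρ i) g) := fun z hz =>
    subset_tsupport _ (ne_of_gt (hc.trans_le hz))
  have hEs : E ⊆ {z | c ≤ mollify (ρ i) g z} := hηlow
  have hcl : MeasurableSet {z | c ≤ mollify (ρ i) g z} :=
    (isClosed_le continuous_const hηc.continuous).measurableSet
  rw [measureReal_restrict_apply hcl]
  refine measureReal_mono (fun z hz => ⟨hEs hz, hDsub (hηD (hsup (hEs hz)))⟩) ?_
  exact ((measure_mono (inter_subset_left.trans hsup)).trans_lt
    (hR _ hηcs.isCompact (hηD.trans hDsub))).ne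

/-! ### Cut-off functions, truncations and the pointwise estimate -/

/-- A cut-off function on a cylinder of radius `R` and half-length `T`, with derivative bounds whose
constant depends on the dimension only: a fixed bump function for the sup norm of space-time,
rescaled separately in space and in time. -/
theorem exists_cutoff (n : ℕ) : ∃ C : ℝ, 0 < C ∧ ∀ (z₀ : SpaceTime n) (R T : ℝ), 0 < R → 0 < T →
    ∃ χ : SpaceTime n → ℝ, IsTestFunction (cylinder (ball z₀.1 R) (z₀.2 - T) (z₀.2 + T)) χ ∧
      (∀ z, 0 ≤ χ z) ∧ (∀ z, χ z ≤ 1) ∧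
      (∀ z, ‖z.1 - z₀.1‖ ≤ 5 / 8 * R → |z.2 - z₀.2| ≤ 5 / 8 * T → χ z = 1) ∧
      (∀ z, ‖spaceGradient χ z‖ ≤ C / R) ∧ ∀ z, |timeDeriv χ z| ≤ C / T := by
  obtain ⟨b, hbi, hbo⟩ : ∃ b : ContDiffBump (0 : SpaceTime n), b.rIn = 5 / 8 ∧ b.rOut = 3 / 4 :=
    ⟨⟨5 / 8, 3 / 4, by norm_num, by norm_num⟩, rfl, rfl⟩
  have hbs : ContDiff ℝ 1 b := b.contDiff
  have hbd : ∀ z, DifferentiableAt ℝ b z := hbs.differentiable one_ne_zero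
  obtain ⟨C, hC⟩ := (hbs.continuous_fderiv one_ne_zero).bounded_above_of_compact_support
    (b.hasCompactSupport.fderiv ℝ)
  have hC0 : 0 ≤ C := (norm_nonneg _).trans (hC 0)
  refine ⟨C + 1, by positivity, fun z₀ R T hR hT => ?_⟩
  let Λ : SpaceTime n →L[ℝ] SpaceTime n :=
    (R⁻¹ • ContinuousLinearMap.id ℝ (Space n)).prodMap (T⁻¹ • ContinuousLinearMap.id ℝ ℝ)
  let S : SpaceTime n → SpaceTime n := fun z => Λ (z - z₀)
  have hS : ContDiff ℝ ∞ S := Λ.contDiff.comp (contDiff_id.sub contDiff_const)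
  have hχs : ContDiff ℝ ∞ (fun z => b (S z)) := b.contDiff.comp hS
  have hχd : ∀ z, DifferentiableAt ℝ (fun z => b (S z)) z := hχs.differentiable (by simp)
  have hSn : ∀ z {ρ : ℝ}, S z ∈ closedBall 0 ρ ↔
      ‖z.1 - z₀.1‖ ≤ ρ * R ∧ |z.2 - z₀.2| ≤ ρ * T := fun z ρ => by
    rw [mem_closedBall_zero_iff, Prod.norm_def, max_le_iff]
    have h1 : (S z).1 = R⁻¹ • (z.1 - z₀.1) := rfl
    have h2 : (S z).2 = T⁻¹ • (z.2 - z₀.2) := rfl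
    rw [h1, h2, norm_smul, norm_smul, norm_inv, norm_inv, Real.norm_of_nonneg hR.le,
      Real.norm_of_nonneg hT.le, Real.norm_eq_abs]
    rw [inv_mul_le_iff₀ hR, inv_mul_le_iff₀ hT, mul_comm R, mul_comm T]
  have hSd : ∀ z, HasFDerivAt S Λ z := fun z =>
    (Λ.hasFDerivAt.comp z ((hasFDerivAt_id z).sub_const z₀) :)
  have hder : ∀ z v, fderiv ℝ (fun z => b (S z)) z v =
      fderiv ℝ b (S z) (R⁻¹ • v.1, T⁻¹ • v.2) := fun z v => by
    have h := ((hbd (S z)).hasFDerivAt.comp z (hSd z)).fderiv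
    have h' : fderiv ℝ (fun z => b (S z)) z = _ := h
    rw [h']
    rfl
  have hsupp : tsupport (fun z => b (S z)) ⊆ {z | S z ∈ closedBall (0 : SpaceTime n) (3 / 4)} := by
    refine closure_minimal (fun z hz => ?_) (isClosed_closedBall.preimage hS.continuous)
    have : S z ∈ Function.support b := hz
    rw [b.support_eq, hbo] at this
    have h2 : S z ∈ closedBall (0 : SpaceTime n) (3 / 4) := ball_subset_closedBall this
    exact h2
  refine ⟨fun z => b (S z), ⟨hχs, ?_, fun z hz => ?_⟩, fun z => b.nonneg, fun z => b.le_one,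
    fun z h1 h2 => b.one_of_mem_closedBall (hbi ▸ (hSn z).2 ⟨h1, h2⟩), fun z => ?_, fun z => ?_⟩
  · refine HasCompactSupport.intro ((isCompact_closedBall z₀.1 (3 / 4 * R)).prod
      (isCompact_closedBall z₀.2 (3 / 4 * T))) fun z hz => ?_
    by_contra h
    have := (hSn z).1 (hsupp (subset_tsupport _ h))
    refine hz ⟨?_, ?_⟩
    · rw [mem_closedBall, dist_eq_norm]; exact this.1
    · rw [mem_closedBall, Real.dist_eq]; exact this.2
  · have := (hSn z).1 (hsupp hz)
    refine ⟨?_, ?_⟩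
    · rw [mem_ball, dist_eq_norm]; linarith [this.1]
    · have h2 := abs_le.1 this.2
      constructor <;> linarith [h2.1, h2.2]
  · set g := spaceGradient (fun z => b (S z)) z with hg
    -- the derivative in the direction of the gradient itself
    have h1 : ‖g‖ * ‖g‖ ≤ C / R * ‖g‖ := by
      rw [← real_inner_self_eq_norm_mul_norm]
      calc inner ℝ g g = fderiv ℝ b (S z) (R⁻¹ • g, 0) := by
            conv_lhs => rw [hg, inner_spaceGradient (hχd z), hder]
            simp [hg]
        _ ≤ ‖fderiv ℝ b (S z)‖ * ‖((R⁻¹ • g, 0) : SpaceTime n)‖ :=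
            (le_abs_self _).trans ((fderiv ℝ b (S z)).le_opNorm _)
        _ ≤ C * (R⁻¹ * ‖g‖) := by
            refine mul_le_mul (hC _) ?_ (norm_nonneg _) hC0
            simp [Prod.norm_def, norm_smul, abs_of_pos hR]
            positivity
        _ = C / R * ‖g‖ := by ring
    have h2 : C / R ≤ (C + 1) / R := by gcongr; linarith
    rcases (norm_nonneg g).eq_or_lt with h0 | h0
    · rw [← h0]; positivity
    · exact (le_of_mul_le_mul_right h1 h0).trans h2
  · rw [timeDeriv_eq_fderiv (hχd z), hder]
    calc |fderiv ℝ b (S z) (R⁻¹ • (0 : Space n), T⁻¹ • (1 : ℝ))|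
        ≤ ‖fderiv ℝ b (S z)‖ * ‖((R⁻¹ • (0 : Space n), T⁻¹ • (1 : ℝ)) : SpaceTime n)‖ :=
          (fderiv ℝ b (S z)).le_opNorm _
      _ ≤ C * T⁻¹ := by
          refine mul_le_mul (hC _) ?_ (norm_nonneg _) hC0
          simp [Prod.norm_def, abs_of_pos hT, hT.le]
      _ ≤ (C + 1) / T := by
          rw [div_eq_mul_inv]; gcongr; linarith

/-- Young's inequality in the form in which the cut-off is absorbed: `χ ^ (m - 1)` carries enough
powers of `χ` because `p ≤ m`. -/
theorem young_cutoff {p ν X χ Y : ℝ} {m : ℕ} (hp : 2 ≤ p) (hpm : p ≤ m) (hν : 0 < ν) (hX : 0 ≤ X)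
    (hχ0 : 0 ≤ χ) (hχ1 : χ ≤ 1) (hY : 0 ≤ Y) :
    Y * χ ^ (m - 1) * X ^ (p - 1) ≤ ν * X ^ p * χ ^ m + ν * (Y / ν) ^ p := by
  have hp1 : 0 < p - 1 := by linarith
  have hm : 2 ≤ m := by exact_mod_cast hp.trans hpm
  have hXp : X ^ p = X * X ^ (p - 1) := by
    rcases hX.eq_or_lt with h | h
    · rw [← h, Real.zero_rpow (by linarith), zero_mul]
    · rw [Real.rpow_sub_one h.ne']; field_simp
  have hχm : χ ^ m = χ * χ ^ (m - 1) := by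
    rw [← pow_succ']; congr 1; omega
  -- Either the coercive term dominates, or `X χ < Y / ν` and the left-hand side is bounded by
  -- `Y (Y / ν) ^ (p - 1)`.
  rcases le_or_gt Y (ν * (X * χ)) with h | h
  · have h1 : Y * (χ ^ (m - 1) * X ^ (p - 1)) ≤ ν * (X * χ) * (χ ^ (m - 1) * X ^ (p - 1)) :=
      mul_le_mul_of_nonneg_right h (by positivity)
    have h2 : 0 ≤ ν * (Y / ν) ^ p := by positivity
    rw [hXp, hχm]
    nlinarith
  · have h1 : X * χ ≤ Y / ν := by rw [le_div_iff₀ hν]; linarith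
    have h2 : χ ^ (m - 1) ≤ χ ^ (p - 1) := by
      rcases hχ0.eq_or_lt with h0 | h0
      · rw [← h0, zero_pow (by omega)]; exact Real.rpow_nonneg le_rfl _
      · rw [← Real.rpow_natCast]
        refine Real.rpow_le_rpow_of_exponent_ge h0 hχ1 ?_
        rw [Nat.cast_sub (by omega)]; push_cast; linarith
    have h3 : χ ^ (m - 1) * X ^ (p - 1) ≤ (Y / ν) ^ (p - 1) := by
      calc _ ≤ χ ^ (p - 1) * X ^ (p - 1) := by gcongr
        _ = (X * χ) ^ (p - 1) := by rw [Real.mul_rpow hX hχ0, mul_comm]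
        _ ≤ _ := Real.rpow_le_rpow (by positivity) h1 hp1.le
    have hYp : ν * (Y / ν) ^ p = Y * (Y / ν) ^ (p - 1) := by
      have hY0 : 0 < Y := lt_of_le_of_lt (by positivity) h
      rw [Real.rpow_sub_one (by positivity)]; field_simp
    have h4 : 0 ≤ ν * X ^ p * χ ^ m := by positivity
    rw [hYp]
    nlinarith [mul_le_mul_of_nonneg_left h3 hY]

theorem hasDerivAt_max_zero_pow (j : ℕ) (x : ℝ) :
    HasDerivAt (fun x : ℝ => max x 0 ^ (j + 2)) ((j + 2) * max x 0 ^ (j + 1)) x := by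
  rcases lt_trichotomy x 0 with h | h | h
  · rw [max_eq_right h.le, zero_pow (by omega), mul_zero]
    refine (hasDerivAt_const x (0 : ℝ)).congr_of_eventuallyEq ?_
    filter_upwards [eventually_lt_nhds h] with y hy
    rw [max_eq_right hy.le, zero_pow (by omega)]
  · subst h
    rw [max_self, zero_pow (by omega), mul_zero, ← hasDerivWithinAt_univ,
      ← Iic_union_Ici (a := (0 : ℝ))]
    refine HasDerivWithinAt.union ?_ ?_
    · refine (hasDerivWithinAt_const (0 : ℝ) _ (0 : ℝ)).congr (fun y hy => ?_) ?_
      · rw [max_eq_right hy, zero_pow (by omega)]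
      · simp
    · have h1 : HasDerivWithinAt (fun y : ℝ => y ^ (j + 2)) 0 (Ici 0) 0 := by
        simpa using (hasDerivAt_pow (j + 2) (0 : ℝ)).hasDerivWithinAt (s := Ici 0)
      refine h1.congr (fun y hy => ?_) ?_
      · rw [max_eq_left hy]
      · simp
  · rw [max_eq_left h.le]
    have h1 : HasDerivAt (fun y : ℝ => y ^ (j + 2)) ((j + 2) * x ^ (j + 1)) x := by
      simpa using hasDerivAt_pow (j + 2) x
    refine h1.congr_of_eventuallyEq ?_
    filter_upwards [eventually_gt_nhds h] with y hy
    rw [max_eq_left hy.le]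

theorem hasDerivAt_max_sub_zero_pow (k : ℝ) (j : ℕ) (s : ℝ) :
    HasDerivAt (fun s : ℝ => max (k - s) 0 ^ (j + 2)) (-((j + 2) * max (k - s) 0 ^ (j + 1))) s := by
  have h := HasDerivAt.comp s (hasDerivAt_max_zero_pow j (k - s)) ((hasDerivAt_id s).const_sub k)
  rw [mul_neg_one] at h
  exact h

theorem deriv_max_sub_zero_sq (k : ℝ) :
    deriv (fun s : ℝ => max (k - s) 0 ^ 2) = fun s => -(2 * max (k - s) 0) := by
  ext s
  simpa using (hasDerivAt_max_sub_zero_pow k 0 s).deriv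

theorem contDiff_max_sub_zero_sq (k : ℝ) : ContDiff ℝ 1 (fun s : ℝ => max (k - s) 0 ^ 2) := by
  refine contDiff_one_iff_deriv.2
    ⟨fun s => (hasDerivAt_max_sub_zero_pow k 0 s).differentiableAt, ?_⟩
  rw [deriv_max_sub_zero_sq]
  fun_prop

theorem spaceGradient_pow {χ : SpaceTime n → ℝ} (hχ : ContDiff ℝ ∞ χ) (m : ℕ) (z : SpaceTime n) :
    spaceGradient (fun z => χ z ^ m) z = (m * χ z ^ (m - 1)) • spaceGradient χ z := by
  have hd := hχ.differentiable (by simp) z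
  refine ext_inner_left ℝ fun v => ?_
  rw [inner_spaceGradient (hd.fun_pow m), inner_smul_right, inner_spaceGradient hd,
    fderiv_fun_pow m hd]
  simp

theorem timeDeriv_pow {χ : SpaceTime n → ℝ} (hχ : ContDiff ℝ ∞ χ) (m : ℕ) (z : SpaceTime n) :
    timeDeriv (fun z => χ z ^ m) z = m * χ z ^ (m - 1) * timeDeriv χ z := by
  have hd := hχ.differentiable (by simp) z
  rw [timeDeriv_eq_fderiv (hd.fun_pow m), timeDeriv_eq_fderiv hd, fderiv_fun_pow m hd]
  simp

/-- The pointwise bound behind the Caccioppoli estimate, with `a = A(∇u)`, `ξ = ∇u` and `g = ∇χ`: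
coercivity absorbs the term that contains `∇χ`. -/
theorem inner_test_le {p ν L w C : ℝ} {m : ℕ} (hp : 2 ≤ p) (hpm : p ≤ m) (hν : 0 < ν) (hL : 0 ≤ L)
    (hw : 0 ≤ w) (hC : 0 ≤ C) {V : Type*} [NormedAddCommGroup V] [InnerProductSpace ℝ V] {a ξ g : V}
    (ha : ν * ‖ξ‖ ^ p ≤ inner ℝ a ξ) (ha' : ‖a‖ ≤ L * ‖ξ‖ ^ (p - 1)) {χ : ℝ} (hχ0 : 0 ≤ χ)
    (hχ1 : χ ≤ 1) (hg : ‖g‖ ≤ C) :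
    inner ℝ a ((-(2 * w) * χ ^ m) • ξ + w ^ 2 • (m * χ ^ (m - 1)) • g) ≤
      w * (2 * ν * (w * (L * m * C) / (2 * ν)) ^ p) := by
  have hy := young_cutoff (Y := w * (L * m * C)) hp hpm (by positivity : 0 < 2 * ν)
    (norm_nonneg ξ) hχ0 hχ1 (by positivity)
  have h1 : inner ℝ a g ≤ L * ‖ξ‖ ^ (p - 1) * C :=
    (real_inner_le_norm a g).trans (by gcongr)
  rw [inner_add_right, inner_smul_right, inner_smul_right, inner_smul_right]
  have h2 : 0 ≤ χ ^ m := by positivity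
  have h3 : 0 ≤ w ^ 2 * (m * χ ^ (m - 1)) := by positivity
  have h4 := mul_le_mul_of_nonneg_left h1 h3
  have h5 := mul_le_mul_of_nonneg_left ha (by positivity : 0 ≤ 2 * w * χ ^ m)
  have h6 := mul_le_mul_of_nonneg_left hy hw
  linarith

/-- An upper bound on a set integral that needs no integrability: the integral of a non-integrable
function is `0`, which is at most the non-negative right-hand side. -/
theorem setIntegral_le_mul_measureReal {X : Type*} [MeasurableSpace X] {m : Measure X} {D : Set X}
    (hD : m D < ⊤) {f : X → ℝ} {C : ℝ} (hC : 0 ≤ C) (h : ∀ᵐ x ∂(m.restrict D), f x ≤ C) :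
    ∫ x in D, f x ∂m ≤ C * m.real D := by
  by_cases hf : IntegrableOn f D m
  · have h1 := integral_mono_ae hf (integrableOn_const (C := C) hD.ne) h
    simpa [mul_comm] using h1
  · rw [integral_undef hf]
    positivity

theorem measureReal_cylinder_ball (x : Space n) (t : ℝ) {R T : ℝ} (hR : 0 < R) (hT : 0 ≤ T) :
    (volume : Measure (SpaceTime n)).real (cylinder (ball x R) (t - T) (t + T)) =
      R ^ n * (volume : Measure (Space n)).real (ball 0 1) * (2 * T) := by
  rw [cylinder, Measure.volume_eq_prod, measureReal_prod_prod, Measure.real,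
    Measure.addHaar_ball_of_pos _ _ hR, Real.volume_real_Ioo, ENNReal.toReal_mul,
    ENNReal.toReal_ofReal (by positivity), finrank_euclideanSpace_fin]
  rw [max_eq_left (by linarith)]
  rw [Measure.real]
  ring

/-! ### The mass of a cylinder -/

/-- The energy estimate. In a cylinder of half-length `T` on which `u ≥ a₀ - δ`, testing with
`((k - u)₊)² χ ^ m` for `k = a₀ + 2δ` bounds the Riesz mass of a set `E` on which
`u ≤ a₀ + δ`; on the cylinder `(k - u)₊ ≤ 3δ`, and on `E` it is at least `δ`. -/
theorem sq_mul_measure_contact_le {p ν L : ℝ} (hp : 2 ≤ p) (hν : 0 < ν) (hL : 0 ≤ L)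
    {A : SpaceTime n → Space n → Space n} {U : Set (SpaceTime n)} (hU : IsOpen U)
    (hA : IsAdmissibleOperator p ν L U A) {u : SpaceTime n → ℝ} {μ : Measure (SpaceTime n)}
    (hμ : IsRieszMeasure p A U u μ) (hu : IsWeakSupersolution p A U u)
    {C : ℝ} (hC0 : 0 < C) {z₀ : SpaceTime n} {R T : ℝ} (hR : 0 < R) (hT : 0 < T)
    (hDU : CompactlyContained (cylinder (ball z₀.1 R) (z₀.2 - T) (z₀.2 + T)) U)
    (huc : ContinuousOn u (closure (cylinder (ball z₀.1 R) (z₀.2 - T) (z₀.2 + T))))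
    {χ : SpaceTime n → ℝ} (hχ : IsTestFunction (cylinder (ball z₀.1 R) (z₀.2 - T) (z₀.2 + T)) χ)
    (hχ0 : ∀ z, 0 ≤ χ z) (hχ1 : ∀ z, χ z ≤ 1) (hχx : ∀ z, ‖spaceGradient χ z‖ ≤ C / R)
    (hχt : ∀ z, |timeDeriv χ z| ≤ C / T) {m : ℕ} (hpm : p ≤ m) {a₀ δ : ℝ} (hδ : 0 < δ)
    (hlow : ∀ z ∈ cylinder (ball z₀.1 R) (z₀.2 - T) (z₀.2 + T), a₀ - δ ≤ u z)
    {E : Set (SpaceTime n)} {s : ℝ} (hs : 0 < s)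
    (hE : ∀ y ∈ E, u y ≤ a₀ + δ ∧ ∀ z ∈ ball y s, χ z = 1) :
    δ ^ 2 / 2 * μ.real E ≤ (9 * δ ^ 3 * (m * (C / T)) +
      3 * δ * (2 * ν * (3 * δ * (L * m * (C / R)) / (2 * ν)) ^ p)) *
      (R ^ n * (volume : Measure (Space n)).real (ball 0 1) * (2 * T)) := by
  obtain ⟨G, hG, -⟩ := hu
  have hvol := measureReal_cylinder_ball z₀.1 z₀.2 hR hT.le
  have hGD := hG _ _ _ isOpen_ball hDU
  have hDo : IsOpen (cylinder (ball z₀.1 R) (z₀.2 - T) (z₀.2 + T)) := isOpen_ball.prod isOpen_Ioo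
  have hm : 2 ≤ m := by exact_mod_cast hp.trans hpm
  set k := a₀ + 2 * δ with hk
  have hφ : IsTestFunction (cylinder (ball z₀.1 R) (z₀.2 - T) (z₀.2 + T)) (fun z => χ z ^ m) := by
    have hsub : tsupport (fun z => χ z ^ m) ⊆ tsupport χ := closure_mono fun z hz h0 => hz (by
      simp only [h0]; exact zero_pow (by omega))
    exact ⟨hχ.1.pow m, hχ.2.1.of_isClosed_subset isClosed_closure hsub, hsub.trans hχ.2.2⟩
  have hF : ∀ s, HasDerivAt (fun s : ℝ => -(max (k - s) 0 ^ 3 / 3)) (max (k - s) 0 ^ 2) s :=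
    fun s => by
      have h := ((hasDerivAt_max_sub_zero_pow k 1 s).div_const 3).fun_neg
      refine h.congr_deriv ?_
      push_cast
      ring
  have hmain := mul_measure_le_of_isRieszMeasure hp hU hA hμ isOpen_ball hDU hGD huc hφ
    (fun z => pow_nonneg (hχ0 z) m) hF (contDiff_max_sub_zero_sq k) (fun s => sq_nonneg _)
    (E := E) (c := δ ^ 2 / 2) hs (by positivity) fun y hy => ⟨by
      have h1 : δ ≤ max (k - u y) 0 := le_max_of_le_left (by linarith [(hE y hy).1])
      have := pow_le_pow_left₀ hδ.le h1 2
      linarith, fun z hz => by simp [(hE y hy).2 z hz]⟩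
  set D := cylinder (ball z₀.1 R) (z₀.2 - T) (z₀.2 + T) with hD
  have hDsub : D ⊆ U := subset_closure.trans hDU.2
  have hDfin : (volume : Measure (SpaceTime n)) D < ⊤ :=
    (measure_mono subset_closure).trans_lt hDU.1.measure_lt_top
  have hw : ∀ z ∈ D, max (k - u z) 0 ≤ 3 * δ := fun z hz =>
    max_le (by linarith [hlow z hz]) (by positivity)
  have hI1 : -(∫ z in D, -(max (k - u z) 0 ^ 3 / 3) * timeDeriv (fun z => χ z ^ m) z) ≤
      9 * δ ^ 3 * (m * (C / T)) * (volume : Measure (SpaceTime n)).real D := by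
    refine (neg_le_abs _).trans ?_
    rw [← Real.norm_eq_abs]
    refine norm_setIntegral_le_of_norm_le_const hDfin fun z hz => ?_
    rw [norm_mul, norm_neg, timeDeriv_pow hχ.1, norm_mul, Real.norm_of_nonneg (by positivity),
      Real.norm_of_nonneg (mul_nonneg (Nat.cast_nonneg _) (pow_nonneg (hχ0 z) _))]
    have h1 : max (k - u z) 0 ^ 3 ≤ (3 * δ) ^ 3 :=
      pow_le_pow_left₀ (le_max_right _ _) (hw z hz) 3
    have h2 : (m : ℝ) * χ z ^ (m - 1) ≤ m :=
      mul_le_of_le_one_right (Nat.cast_nonneg _) (pow_le_one₀ (hχ0 z) (hχ1 z))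
    refine mul_le_mul ?_ (mul_le_mul h2 (hχt z) (norm_nonneg _) (Nat.cast_nonneg _))
      (mul_nonneg (mul_nonneg (Nat.cast_nonneg _) (pow_nonneg (hχ0 z) _)) (norm_nonneg _))
      (by positivity)
    linarith
  have hI2 : ∫ z in D, inner ℝ (A z (G z))
        ((deriv (fun s : ℝ => max (k - s) 0 ^ 2) (u z) * χ z ^ m) • G z +
          max (k - u z) 0 ^ 2 • spaceGradient (fun z => χ z ^ m) z) ≤
      3 * δ * (2 * ν * (3 * δ * (L * m * (C / R)) / (2 * ν)) ^ p) *
        (volume : Measure (SpaceTime n)).real D := by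
    refine setIntegral_le_mul_measureReal hDfin (by positivity) ?_
    filter_upwards [ae_restrict_of_ae_restrict_of_subset hDsub hA.coercive,
      ae_restrict_of_ae_restrict_of_subset hDsub hA.growth,
      ae_restrict_mem hDo.measurableSet] with z h1 h2 hz
    rw [deriv_max_sub_zero_sq, spaceGradient_pow hχ.1]
    have hw0 : 0 ≤ max (k - u z) 0 := le_max_right _ _
    refine (inner_test_le hp hpm hν hL hw0 (by positivity : 0 ≤ C / R) (h1 (G z)) (h2 (G z))
      (hχ0 z) (hχ1 z) (hχx z)).trans ?_
    have h3 := hw z hz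
    gcongr
  rw [← hvol]
  linarith

/-- The density bound for the Riesz measure at a single point `z₀` of an open set `U`. The function
`u` lies above `ψ`, is a supersolution, and is a solution where it does not touch `ψ`. -/
theorem exists_measure_intrinsicCylinder_le (n : ℕ) (p ν L M : ℝ) (hp : 2 ≤ p) (hν : 0 < ν)
    (hL : 0 < L) (hM : 0 < M) :
    ∃ c : ℝ, 0 < c ∧
      ∀ (U : Set (SpaceTime n)) (A : SpaceTime n → Space n → Space n) (α : ℝ)
        (ψ u : SpaceTime n → ℝ) (μ : Measure (SpaceTime n)) (z₀ : SpaceTime n) (r : ℝ),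
        IsOpen U → IsAdmissibleOperator p ν L U A → 0 < α → α ≤ 1 → ContinuousOn ψ U →
        ContinuousOn u U → (∀ z ∈ U, ψ z ≤ u z) → IsWeakSupersolution p A U u →
        IsWeakSolution p A {z ∈ U | ψ z < u z} u → IsRieszMeasure p A U u μ →
        (∀ z ∈ U, |ψ z₀ - ψ z| ≤ M * dAlpha p α z₀ z ^ α) → 0 < r →
        CompactlyContained (intrinsicCylinder p (2 * r) ((2 * r) ^ α) z₀) U →
        μ (intrinsicCylinder p r (r ^ α) z₀) ≤ ENNReal.ofReal (c * r ^ ((n : ℝ) + α)) := by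
  obtain ⟨C, hC, hcut⟩ := exists_cutoff n
  obtain ⟨m, hpm⟩ : ∃ m : ℕ, p ≤ m := exists_nat_ge p
  have hm : 0 < (m : ℝ) := by linarith
  set κ := (volume : Measure (Space n)).real (ball 0 1) with hκ
  have hκ0 : 0 < κ := by
    rw [hκ, Measure.real]
    exact ENNReal.toReal_pos (measure_ball_pos _ _ one_pos).ne' measure_ball_lt_top.ne
  set H := (3 * M * (L * m * C) / (2 * ν)) ^ p with hH
  have hH0 : 0 < H := by positivity
  set c₀ := 2 / M ^ 2 * (18 * M ^ 3 * (m * C) + 12 * ν * M * H) * κ with hc₀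
  have hc₀0 : 0 < c₀ := by positivity
  refine ⟨c₀ * 2 ^ ((n : ℝ) + 1), by positivity, ?_⟩
  intro U A α ψ u μ z₀ r hU hA hα hα1 hψ hu hψu hsup hsol hμ hM' hr hcomp
  -- geometry of the two cylinders
  set R := 2 * r with hR
  have hR0 : 0 < R := by positivity
  set Q := R ^ α with hQ
  have hQ0 : 0 < Q := by positivity
  set T := Q ^ (2 - p) * R ^ p with hT
  have hT0 : 0 < T := by positivity
  -- `p ≥ 2` and `α ≤ 1` give the time scale an exponent at least `2`, so that `d_α` is not
  -- degenerate and halving the radius divides the half-length by at least `4`.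
  have hσ2 : 2 ≤ p + α * (2 - p) := by nlinarith
  have hTσ : ∀ x : ℝ, 0 < x → (x ^ α) ^ (2 - p) * x ^ p = x ^ (p + α * (2 - p)) := fun x hx => by
    rw [← Real.rpow_mul hx.le, ← Real.rpow_add hx, add_comm]
  have hTR : T = R ^ (p + α * (2 - p)) := hTσ R hR0
  set τ := (r ^ α) ^ (2 - p) * r ^ p with hτ
  have hτT : 4 * τ ≤ T := by
    rw [hTR, hτ, hTσ r hr, hR, Real.mul_rpow (by norm_num) hr.le]
    refine mul_le_mul_of_nonneg_right ?_ (by positivity)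
    calc (4 : ℝ) = 2 ^ (2 : ℝ) := by norm_num
      _ ≤ _ := Real.rpow_le_rpow_of_exponent_le (by norm_num) hσ2
  set δ := M * Q with hδ
  have hδ0 : 0 < δ := by positivity
  set D := cylinder (ball z₀.1 R) (z₀.2 - T) (z₀.2 + T) with hD
  have hDU : CompactlyContained D U := hcomp
  have hDsub : D ⊆ U := subset_closure.trans hDU.2
  have hosc : ∀ z ∈ D, |ψ z₀ - ψ z| ≤ δ := fun z hz => by
    have hd : dAlpha p α z₀ z ≤ R := by
      refine max_le ?_ ?_
      · have := mem_ball.1 hz.1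
        rw [dist_comm, dist_eq_norm] at this
        exact this.le
      · have h1 : |z₀.2 - z.2| ≤ T := by
          have := hz.2
          rw [abs_le]; constructor <;> linarith [this.1, this.2]
        calc |z₀.2 - z.2| ^ (1 / (p + α * (2 - p))) ≤ T ^ (1 / (p + α * (2 - p))) :=
              Real.rpow_le_rpow (abs_nonneg _) h1 (by positivity)
          _ = R := by
              rw [hTR, ← Real.rpow_mul hR0.le, mul_one_div_cancel (by linarith), Real.rpow_one]
    have hd0 : 0 ≤ dAlpha p α z₀ z := le_max_of_le_left (norm_nonneg _)
    exact (hM' z (hDsub hz)).trans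
      (mul_le_mul_of_nonneg_left (Real.rpow_le_rpow hd0 hd hα.le) hM.le)
  -- the mass sits on the contact set
  set E := intrinsicCylinder p r (r ^ α) z₀ ∩ {z | u z = ψ z} with hE
  have hQD : intrinsicCylinder p r (r ^ α) z₀ ⊆ D := fun z hz => by
    have h2 := hz.2
    refine ⟨ball_subset_ball (by linarith) hz.1, ?_, ?_⟩
    · linarith [h2.1]
    · linarith [h2.2]
  have hW : IsOpen {z ∈ U | ψ z < u z} := by
    have h := (hu.sub hψ).isOpen_inter_preimage hU isOpen_Ioi (t := Ioi 0)
    convert h using 1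
    ext z
    simp
  have hW0 := measure_eq_zero_of_isWeakSolution hp hU hW (sep_subset _ _) hμ hsol
  have hle : μ (intrinsicCylinder p r (r ^ α) z₀) ≤ μ E := by
    calc _ ≤ μ (E ∪ {z ∈ U | ψ z < u z}) := measure_mono fun z hz => by
          rcases (hψu z (hDsub (hQD hz))).eq_or_lt with h | h
          · exact Or.inl ⟨hz, h.symm⟩
          · exact Or.inr ⟨hDsub (hQD hz), h⟩
      _ ≤ μ E + μ {z ∈ U | ψ z < u z} := measure_union_le _ _
      _ = μ E := by rw [hW0, add_zero]
  have hEfin : μ E ≠ ⊤ := ((measure_mono (inter_subset_left.trans (hQD.trans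
    subset_closure))).trans_lt (hμ.1 _ hDU.1 hDU.2)).ne
  -- The smaller cylinder has radius `R / 2` and half-length `τ ≤ T / 4`, so its points stay
  -- inside the region `{χ = 1}`, of relative size `5 / 8`, when moved by less than `r / 4 = R / 8` in
  -- space and `T / 4` in time.
  obtain ⟨χ, hχ, hχ0, hχ1, hχone, hχx, hχt⟩ := hcut z₀ R T hR0 hT0
  have hest := sq_mul_measure_contact_le hp hν hL.le hU hA hμ hsup hC hR0 hT0 hDU
    (hu.mono hDU.2) hχ hχ0 hχ1 hχx hχt hpm (a₀ := ψ z₀) hδ0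
    (fun z hz => by linarith [(abs_le.1 (hosc z hz)).2, hψu z (hDsub hz)])
    (E := E) (s := min (r / 4) (T / 4)) (by positivity) fun y hy => by
      refine ⟨?_, fun z hz => hχone z ?_ ?_⟩
      · have h1 := (abs_le.1 (hosc y (hQD hy.1))).1
        have h2 : u y = ψ y := hy.2
        linarith
      · have h1 := mem_ball.1 hy.1.1
        have h2 : dist z.1 y.1 < r / 4 :=
          ((le_max_left _ _).trans_lt (mem_ball.1 hz)).trans_le (min_le_left _ _)
        rw [← dist_eq_norm]
        linarith [dist_triangle z.1 y.1 z₀.1]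
      · have h1 := hy.1.2
        have h2 : dist z.2 y.2 < T / 4 :=
          ((le_max_right _ _).trans_lt (mem_ball.1 hz)).trans_le (min_le_right _ _)
        rw [Real.dist_eq, abs_lt] at h2
        rw [abs_le]
        constructor <;> linarith [h1.1, h1.2, h2.1, h2.2]
  -- collecting the powers of `R`
  have hscale : T * (3 * δ * (L * m * (C / R)) / (2 * ν)) ^ p = Q ^ 2 * H := by
    have e1 : 3 * δ * (L * m * (C / R)) / (2 * ν) = (3 * M * (L * m * C) / (2 * ν)) * (Q / R) := by
      rw [hδ]; field_simp
    rw [e1, Real.mul_rpow (by positivity) (by positivity), Real.div_rpow hQ0.le hR0.le, ← hH, hT,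
      Real.rpow_sub hQ0, Real.rpow_two]
    field_simp
  have hreal : μ.real E ≤ c₀ * (Q * R ^ n) := by
    have h1 : (9 * δ ^ 3 * (m * (C / T)) +
        3 * δ * (2 * ν * (3 * δ * (L * m * (C / R)) / (2 * ν)) ^ p)) * (R ^ n * κ * (2 * T)) =
        δ ^ 2 / 2 * (c₀ * (Q * R ^ n)) := by
      calc _ = 18 * δ ^ 3 * (m * C) * R ^ n * κ + 12 * δ * ν * R ^ n * κ *
            (T * (3 * δ * (L * m * (C / R)) / (2 * ν)) ^ p) := by
            field_simp
            ring
        _ = _ := by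
            rw [hscale, hc₀, hδ]
            field_simp
    rw [h1] at hest
    exact le_of_mul_le_mul_left hest (by positivity)
  -- `α ≤ 1` makes the power of `2` independent of `α`.
  have hpow : Q * R ^ n ≤ 2 ^ ((n : ℝ) + 1) * r ^ ((n : ℝ) + α) := by
    rw [hQ, ← Real.rpow_natCast, ← Real.rpow_add hR0, add_comm α, hR,
      Real.mul_rpow (by norm_num) hr.le]
    gcongr
    norm_num
  calc μ (intrinsicCylinder p r (r ^ α) z₀) ≤ μ E := hle
    _ = ENNReal.ofReal (μ.real E) := (ENNReal.ofReal_toReal hEfin).symm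
    _ ≤ _ := ENNReal.ofReal_le_ofReal (hreal.trans (by
        rw [mul_assoc c₀]
        exact mul_le_mul_of_nonneg_left hpow hc₀0.le))

end

end PParabolic

theorem mainTheorem5 (n : ℕ) (hn : 1 ≤ n) (p ν L M : ℝ) (hp : 2 ≤ p) (hν : 0 < ν) (hνL : ν ≤ L)
    (hM : 0 < M) :
    ∃ c : ℝ, 0 < c ∧
      ∀ (Ω : Set (PParabolic.Space n)) (T : ℝ)
        (A : PParabolic.SpaceTime n → PParabolic.Space n → PParabolic.Space n)
        (α : ℝ) (K : Set (PParabolic.SpaceTime n)) (ψ u : PParabolic.SpaceTime n → ℝ)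
        (μ : Measure (PParabolic.SpaceTime n)),
        IsOpen Ω → 0 < T →
        PParabolic.IsAdmissibleOperator p ν L (PParabolic.cylinder Ω 0 T) A →
        0 < α → α ≤ 1 →
        IsCompact K → K ⊆ PParabolic.cylinder Ω 0 T →
        ContinuousOn ψ (closure (PParabolic.cylinder Ω 0 T)) →
        (∀ z₁ ∈ K, ∀ z₂ ∈ PParabolic.cylinder Ω 0 T,
          |ψ z₁ - ψ z₂| ≤ M * PParabolic.dAlpha p α z₁ z₂ ^ α) →
        PParabolic.IsObstacleSolution p A Ω 0 T ψ u →
        PParabolic.IsRieszMeasure p A (PParabolic.cylinder Ω 0 T) u μ →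
        ∀ z₀ ∈ K, ∀ r : ℝ, 0 < r →
          PParabolic.CompactlyContained
            (PParabolic.intrinsicCylinder p (2 * r) ((2 * r) ^ α) z₀)
            (PParabolic.cylinder Ω 0 T) →
          μ (PParabolic.intrinsicCylinder p r (r ^ α) z₀) ≤
            ENNReal.ofReal (c * r ^ ((n : ℝ) + α)) := by
  obtain ⟨c, hc, h⟩ := PParabolic.exists_measure_intrinsicCylinder_le n p ν L M hp hν
    (hν.trans_le hνL) hM
  refine ⟨c, hc, ?_⟩
  intro Ω T A α K ψ u μ hΩ _ hA hα hα1 _ _ hψ hψM hu hμ z₀ hz₀ r hr hcomp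
  exact h _ A α ψ u μ z₀ r (hΩ.prod isOpen_Ioo) hA hα hα1 (hψ.mono subset_closure)
    (hu.continuousOn.mono subset_closure) hu.obstacle_le hu.supersolution
    hu.solution_off_contact hμ (hψM z₀ hz₀) hr hcomp
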